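/- Let $R$ be a Gorenstein local ring, that is, a commutative Noetherian local ring of finite injective dimension as a module over itself, and let $M$ be a nonzero finitely generated $R$-module. Then the following conditions are equivalent. (i) $M$ is G-Gorenstein, i.e. its Cousin complex $C(M)$ is a Gorenstein injective resolution of $M$. (ii) $M$ is Gorenstein projective. Here the notions are as follows. * An $R$-module $N$ is *Gorenstein injective* if there is an exact sequence $\cdots\to E_1\to E_0\to E^0\to E^1\to\cdots$ of injective $R$-modules which remains exact under $\operatorname{Hom}_R(I,-)$ for every injective $R$-module $I$, with $N\cong\ker(E^0\to E^1)$. It is *Gorenstein projective* if there is an exact sequence $\cdots\to P_1\to P_0\to P^0\to P^1\to\cdots$ of projective $R$-modules which remains exact under $\operatorname{Hom}_R(-,Q)$ for every projective $R$-module $Q$, with $N\cong\ker(P^0\to P^1)$. * A *Gorenstein injective resolution* of $N$ is an exact sequence $0\to N\to G^0\to G^1\to\cdots$ in which every $G^i$ is Gorenstein injective. * For $\mathfrak p\in\operatorname{Supp}_R M$ let $\operatorname{ht}_M\mathfrak p$ be the supremum of the lengths $n$ of chains $\mathfrak p_0\subsetneq\cdots\subsetneq\mathfrak p_n=\mathfrak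 p$ of primes in $\operatorname{Supp}_R M$. The *Cousin complex* $C(M)$ (with respect to the $M$-height filtration) is the complex $$0\to M\xrightarrow{d^{-1}}M^0\xrightarrow{d^0}M^1\xrightarrow{d^1}\cdots$$ defined inductively, with $M^{-1}=M$ and $d^{-2}\colon 0\to M$, by $$M^i=\bigoplus_{\mathfrak p\in\operatorname{Supp}_R M,\ \operatorname{ht}_M\mathfrak p=i}(\operatorname{coker}d^{i-2})_{\mathfrak p}\qquad(i\ge 0),$$ where, for $x\in M^{i-1}$, the component of $d^{i-1}(x)$ in $(\operatorname{coker}d^{i-2})_{\mathfrak p}$ is $\pi(x)/1$, with $\pi\colon M^{i-1}\to\operatorname{coker}d^{i-2}$ the canonical epimorphism. -/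

import Mathlib

open scoped DirectSum

universe u

noncomputable section

/-! ### Gorenstein local rings -/

/-- A Gorenstein local ring: a commutative Noetherian local ring which has finite injective
dimension as a module over itself. -/
class IsGorensteinLocalRing (R : Type u) [CommRing R] : Prop
    extends IsNoetherianRing R, IsLocalRing R where
  finite_injectiveDimension :
    ∃ n : ℕ, CategoryTheory.HasInjectiveDimensionLE (ModuleCat.of R R) n

/-! ### Gorenstein injective and Gorenstein projective modules -/

section Gorenstein

variable (R : Type u) [CommRing R]

/-- `N` is Gorenstein injective: there is an exact sequence
`⋯ → E (-1) → E 0 → E 1 → ⋯` of injective modules, which stays exact under `Hom(I, -)` for every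
injective module `I`, such that `N` is isomorphic to the kernel of `E 0 → E 1`. -/
def IsGorensteinInjective (N : Type u) [AddCommGroup N] [Module R N] : Prop :=
  ∃ (E : ℤ → ModuleCat.{u} R) (d : ∀ n : ℤ, E n →ₗ[R] E (n + 1)),
    (∀ n, Module.Injective R (E n)) ∧
    (∀ n, Function.Exact (d n) (d (n + 1))) ∧
    (∀ I : ModuleCat.{u} R, Module.Injective R I → ∀ n,
      Function.Exact (fun f : I →ₗ[R] E n => d n ∘ₗ f)
        (fun f : I →ₗ[R] E (n + 1) => d (n + 1) ∘ₗ f)) ∧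
    Nonempty (N ≃ₗ[R] LinearMap.ker (d 0))

/-- `M` is Gorenstein projective: there is an exact sequence
`⋯ → P (-1) → P 0 → P 1 → ⋯` of projective modules, which stays exact under `Hom(-, Q)` for every
projective module `Q`, such that `M` is isomorphic to the kernel of `P 0 → P 1`. -/
def IsGorensteinProjective (M : Type u) [AddCommGroup M] [Module R M] : Prop :=
  ∃ (P : ℤ → ModuleCat.{u} R) (d : ∀ n : ℤ, P n →ₗ[R] P (n + 1)),
    (∀ n, Module.Projective R (P n)) ∧
    (∀ n, Function.Exact (d n) (d (n + 1))) ∧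
    (∀ Q : ModuleCat.{u} R, Module.Projective R Q → ∀ n,
      Function.Exact (fun f : P (n + 1 + 1) →ₗ[R] Q => f ∘ₗ d (n + 1))
        (fun f : P (n + 1) →ₗ[R] Q => f ∘ₗ d n)) ∧
    Nonempty (M ≃ₗ[R] LinearMap.ker (d 0))

variable {R}

/-- The sequence `0 → N → G 0 → G 1 → ⋯` is a Gorenstein injective resolution of `N`: it is exact
and all `G i` are Gorenstein injective. -/
structure IsGorensteinInjectiveResolution {N : Type u} [AddCommGroup N] [Module R N]
    (G : ℕ → ModuleCat.{u} R) (ε : N →ₗ[R] G 0) (d : ∀ i, G i →ₗ[R] G (i + 1)) : Prop where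
  injective : Function.Injective ε
  exact_zero : Function.Exact ε (d 0)
  exact_succ : ∀ i, Function.Exact (d i) (d (i + 1))
  gorensteinInjective : ∀ i, IsGorensteinInjective R (G i)

end Gorenstein

/-! ### Filtrations of the spectrum -/

/-- A filtration of `Spec R`: a descending sequence `F 0 ⊇ F 1 ⊇ ⋯` of subsets such that each
member of `F i \ F (i + 1)` is a minimal member of `F i` with respect to inclusion. -/
structure SpecFiltration (R : Type u) [CommRing R] where
  F : ℕ → Set (PrimeSpectrum R)
  succ_subset : ∀ i, F (i + 1) ⊆ F i
  minimal : ∀ i, ∀ p ∈ F i \ F (i + 1), Minimal (· ∈ F i) p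

/-- The set `∂F i = F i \ F (i + 1)`. -/
def SpecFiltration.boundary {R : Type u} [CommRing R] (𝓕 : SpecFiltration R) (i : ℕ) :
    Set (PrimeSpectrum R) := 𝓕.F i \ 𝓕.F (i + 1)

/-- The `M`-height of a prime `p` in the support of `M`, i.e. the supremum of the lengths `n` of the
chains `p₀ ⊂ ⋯ ⊂ pₙ = p` of primes in the support of `M` (this is the dimension of `Mₚ`). -/
def moduleHeight (R : Type u) [CommRing R] (M : Type u) [AddCommGroup M] [Module R M]
    (p : Module.support R M) : ℕ∞ := Order.height p

/-- The `M`-height filtration `K i = {p ∈ Supp M | ht_M p ≥ i}`. -/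
def heightFiltration (R : Type u) [CommRing R] (M : Type u) [AddCommGroup M] [Module R M] :
    SpecFiltration R where
  F i := {p | ∃ h : p ∈ Module.support R M, (i : ℕ∞) ≤ moduleHeight R M ⟨p, h⟩}
  succ_subset i p := by
    rintro ⟨h, hi⟩
    exact ⟨h, le_trans (by exact_mod_cast Nat.le_succ i) hi⟩
  minimal i p := by
    rintro ⟨⟨h, hi⟩, hp⟩
    refine ⟨⟨h, hi⟩, ?_⟩
    rintro q ⟨hq, hqi⟩ hqp
    by_contra hpq
    refine hp ⟨h, ?_⟩
    have hlt : (⟨q, hq⟩ : Module.support R M) < ⟨p, h⟩ := lt_of_le_not_ge hqp hpq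
    have := Order.height_add_one_le hlt
    push_cast
    exact le_trans (by gcongr; exact hqi) this

/-! ### The Cousin complex -/

namespace Cousin

section Step

variable {R : Type u} [CommRing R]

/-- The direct sum of the localizations `Nₚ` over the primes `p` in the set `S`. -/
abbrev Term (S : Set (PrimeSpectrum R)) (N : Type u) [AddCommGroup N] [Module R N] : Type u :=
  ⨁ p : S, LocalizedModule p.1.asIdeal.primeCompl N

variable {S : Set (PrimeSpectrum R)} {N : Type u} [AddCommGroup N] [Module R N]

/-- The function underlying `Cousin.toTerm`. -/
def toTermFun
    (h : ∀ x : N, {p : S | LocalizedModule.mkLinearMap p.1.asIdeal.primeCompl N x ≠ 0}.Finite)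
    (x : N) : Term S N :=
  letI := Classical.decEq S
  DirectSum.mk _ (h x).toFinset fun p => LocalizedModule.mkLinearMap p.1.1.asIdeal.primeCompl N x

theorem toTermFun_apply
    (h : ∀ x : N, {p : S | LocalizedModule.mkLinearMap p.1.asIdeal.primeCompl N x ≠ 0}.Finite)
    (x : N) (p : S) :
    toTermFun h x p = LocalizedModule.mkLinearMap p.1.asIdeal.primeCompl N x := by
  let := Classical.decEq S
  by_cases hp : p ∈ (h x).toFinset
  · exact DirectSum.mk_apply_of_mem hp
  · refine (DirectSum.mk_apply_of_notMem hp).trans ?_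
    simpa [eq_comm] using hp

/-- The map `N → ⨁ Nₚ` whose component at `p` sends `x` to `x / 1`; it needs that, for each `x`,
only finitely many of these fractions are nonzero. -/
def toTerm
    (h : ∀ x : N, {p : S | LocalizedModule.mkLinearMap p.1.asIdeal.primeCompl N x ≠ 0}.Finite) :
    N →ₗ[R] Term S N where
  toFun := toTermFun h
  map_add' x y := DFinsupp.ext fun p => by
    change toTermFun h (x + y) p = toTermFun h x p + toTermFun h y p
    rw [toTermFun_apply, toTermFun_apply, toTermFun_apply, map_add]
  map_smul' r x := DFinsupp.ext fun p => by
    change toTermFun h (r • x) p = r • toTermFun h x p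
    rw [toTermFun_apply, toTermFun_apply, map_smul]

theorem toTerm_apply
    (h : ∀ x : N, {p : S | LocalizedModule.mkLinearMap p.1.asIdeal.primeCompl N x ≠ 0}.Finite)
    (x : N) (p : S) :
    toTerm h x p = LocalizedModule.mkLinearMap p.1.asIdeal.primeCompl N x :=
  toTermFun_apply h x p

theorem mkLinearMap_eq_zero_iff (p : PrimeSpectrum R) (x : N) :
    LocalizedModule.mkLinearMap p.asIdeal.primeCompl N x = 0 ↔
      ∃ t, t ∉ p.asIdeal ∧ t • x = 0 := by
  rw [IsLocalizedModule.eq_zero_iff p.asIdeal.primeCompl]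
  constructor
  · rintro ⟨t, ht⟩
    exact ⟨t.1, t.2, ht⟩
  · rintro ⟨t, ht, h⟩
    exact ⟨⟨t, ht⟩, h⟩

end Step

section Complex

variable {R : Type u} [CommRing R] (𝓕 : SpecFiltration R)
variable {N : Type u} [AddCommGroup N] [Module R N]

theorem mem_minimalPrimes {i : ℕ} (hN : Module.support R N ⊆ 𝓕.F i) {p : PrimeSpectrum R}
    (hp : p ∈ 𝓕.boundary i) {x : N}
    (hx : LocalizedModule.mkLinearMap p.asIdeal.primeCompl N x ≠ 0) :
    p.asIdeal ∈ (Submodule.span R {x}).annihilator.minimalPrimes := by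
  have key : ∀ t, t • x = 0 → t ∈ p.asIdeal := by
    intro t ht
    by_contra h
    exact hx ((mkLinearMap_eq_zero_iff p x).2 ⟨t, h, ht⟩)
  refine ⟨⟨p.2, fun t ht => key t ?_⟩, ?_⟩
  · exact (Submodule.mem_annihilator_span_singleton x t).1 ht
  · rintro q ⟨hq, hqx⟩ hqp
    have : (⟨q, hq⟩ : PrimeSpectrum R) ∈ 𝓕.F i :=
      hN (Module.mem_support_iff_exists_annihilator.2 ⟨x, hqx⟩)
    exact (𝓕.minimal i p hp).2 this hqp

theorem finite_ne_zero [IsNoetherianRing R] {i : ℕ} (hN : Module.support R N ⊆ 𝓕.F i) (x : N) :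
    {p : 𝓕.boundary i |
      LocalizedModule.mkLinearMap p.1.asIdeal.primeCompl N x ≠ 0}.Finite := by
  refine Set.Finite.of_finite_image (f := fun p => p.1.asIdeal)
    ((Ideal.finite_minimalPrimes_of_isNoetherianRing R
      (Submodule.span R {x}).annihilator).subset ?_) ?_
  · rintro _ ⟨p, hp, rfl⟩
    exact mem_minimalPrimes 𝓕 hN p.2 hp
  · intro p _ q _ h
    exact Subtype.ext (PrimeSpectrum.ext h)

theorem exists_smul_eq_zero {i : ℕ} (hN : Module.support R N ⊆ 𝓕.F i) {p q : PrimeSpectrum R}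
    (hp : p ∈ 𝓕.boundary i) (hq : q ∉ 𝓕.F (i + 1)) (hpq : p ≠ q) (x : N) :
    ∃ s, s ∉ q.asIdeal ∧ s • LocalizedModule.mkLinearMap p.asIdeal.primeCompl N x = 0 := by
  by_cases hx : LocalizedModule.mkLinearMap p.asIdeal.primeCompl N x = 0
  · exact ⟨1, fun h => q.2.ne_top ((Ideal.eq_top_iff_one _).2 h), by rw [hx, smul_zero]⟩
  by_cases hqi : q ∈ 𝓕.F i
  · have hmin := mem_minimalPrimes 𝓕 hN hp hx
    have hnle : ¬ p.asIdeal ≤ q.asIdeal := fun hle =>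
      hpq (le_antisymm hle ((𝓕.minimal i q ⟨hqi, hq⟩).2 hp.1 hle))
    obtain ⟨a, hap, haq⟩ := SetLike.not_le_iff_exists.1 hnle
    let T : Submonoid R := p.asIdeal.primeCompl ⊔ Submonoid.powers a
    by_cases hd : Disjoint ((Submodule.span R {x}).annihilator : Set R) (T : Set R)
    · obtain ⟨r, hr, hxr, hrT⟩ := Ideal.exists_le_prime_disjoint _ T hd
      have hrp : r ≤ p.asIdeal := by
        intro b hb
        by_contra hbp
        exact Set.disjoint_left.1 hrT hb
          ((le_sup_left : p.asIdeal.primeCompl ≤ T) hbp)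
      have har : a ∈ r := hmin.2 ⟨hr, hxr⟩ hrp hap
      exact absurd ((le_sup_right : Submonoid.powers a ≤ T) (Submonoid.mem_powers a))
        (Set.disjoint_left.1 hrT har)
    · obtain ⟨b, hbx, hbT⟩ := Set.not_disjoint_iff.1 hd
      obtain ⟨t, ht, _, ⟨k, rfl⟩, rfl⟩ := Submonoid.mem_sup.1 hbT
      refine ⟨a ^ k, fun h => haq (q.2.mem_of_pow_mem k h), ?_⟩
      rw [← map_smul, mkLinearMap_eq_zero_iff]
      refine ⟨t, ht, ?_⟩
      rw [smul_smul]
      exact (Submodule.mem_annihilator_span_singleton x _).1 hbx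
  · have : q ∉ Module.support R N := fun h => hqi (hN h)
    obtain ⟨s, hs, hsx⟩ := Module.notMem_support_iff'.1 this x
    exact ⟨s, hs, by rw [← map_smul, hsx, map_zero]⟩

/-- The localization map `N → ⨁_{p ∈ ∂F i} Nₚ` for a module with support in `F i`. -/
def map [IsNoetherianRing R] {i : ℕ} (hN : Module.support R N ⊆ 𝓕.F i) :
    N →ₗ[R] Term (𝓕.boundary i) N :=
  toTerm (finite_ne_zero 𝓕 hN)

theorem support_coker_subset [IsNoetherianRing R] {i : ℕ} (hN : Module.support R N ⊆ 𝓕.F i) :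
    Module.support R (Term (𝓕.boundary i) N ⧸ LinearMap.range (map 𝓕 hN)) ⊆ 𝓕.F (i + 1) := by
  classical
  intro q hq
  by_contra hqi
  have claim : ∀ y : Term (𝓕.boundary i) N,
      ∃ s, s ∉ q.asIdeal ∧ s • y ∈ LinearMap.range (map 𝓕 hN) := by
    have hone : (1 : R) ∉ q.asIdeal := fun h => q.2.ne_top ((Ideal.eq_top_iff_one _).2 h)
    have hmul : ∀ a b : R, a ∉ q.asIdeal → b ∉ q.asIdeal → a * b ∉ q.asIdeal :=
      fun a b ha hb h => (q.2.mem_or_mem h).elim ha hb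
    -- away from `q` every component is killed by some element outside `q`
    have kill : ∀ (x : N) (p : 𝓕.boundary i), p.1 ≠ q → ∃ s, s ∉ q.asIdeal ∧
        s • LocalizedModule.mkLinearMap p.1.asIdeal.primeCompl N x = 0 :=
      fun x p hpq => exists_smul_eq_zero 𝓕 hN p.2 hqi hpq x
    intro y
    induction y using DirectSum.induction_on with
    | zero => exact ⟨1, hone, by simp⟩
    | add y z hy hz =>
      obtain ⟨s, hs, hsy⟩ := hy
      obtain ⟨t, ht, htz⟩ := hz
      refine ⟨s * t, hmul _ _ hs ht, ?_⟩
      rw [smul_add]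
      refine add_mem ?_ ?_
      · rw [mul_comm, mul_smul]
        exact Submodule.smul_mem _ _ hsy
      · rw [mul_smul]
        exact Submodule.smul_mem _ _ htz
    | of p z =>
      obtain ⟨⟨x, t⟩, hxt⟩ := IsLocalizedModule.surj p.1.asIdeal.primeCompl
        (LocalizedModule.mkLinearMap p.1.asIdeal.primeCompl N) z
      change t.1 • z = _ at hxt
      by_cases hpq : p.1 = q
      · -- clear the components of the image of `x` away from `q`
        have hfin : ∀ A : Finset (𝓕.boundary i), ∃ s, s ∉ q.asIdeal ∧ ∀ p' ∈ A, p'.1 ≠ q →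
            s • LocalizedModule.mkLinearMap p'.1.asIdeal.primeCompl N x = 0 := by
          intro A
          induction A using Finset.induction_on with
          | empty => exact ⟨1, hone, by simp⟩
          | insert p' A _ ih =>
            obtain ⟨s, hs, hA⟩ := ih
            by_cases h' : p'.1 = q
            · refine ⟨s, hs, fun p'' h'' hne => ?_⟩
              rcases Finset.mem_insert.1 h'' with rfl | h''
              · exact absurd h' hne
              · exact hA _ h'' hne
            · obtain ⟨t', ht', hk⟩ := kill x p' h'
              refine ⟨s * t', hmul _ _ hs ht', fun p'' h'' hne => ?_⟩
              rcases Finset.mem_insert.1 h'' with rfl | h''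
              · rw [mul_smul, hk, smul_zero]
              · rw [mul_comm, mul_smul, hA _ h'' hne, smul_zero]
        obtain ⟨s, hs, hA⟩ := hfin (finite_ne_zero 𝓕 hN x).toFinset
        refine ⟨s * t.1, hmul _ _ hs (hpq ▸ t.2), s • x, ?_⟩
        refine DFinsupp.ext fun p' => ?_
        change (map 𝓕 hN (s • x)) p' = (((s * t.1) • DirectSum.of (fun p : 𝓕.boundary i =>
          LocalizedModule p.1.asIdeal.primeCompl N) p z : Term (𝓕.boundary i) N)) p'
        rw [map_smul, DirectSum.smul_apply, DirectSum.smul_apply, map, toTerm_apply]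
        by_cases hpp : p' = p
        · subst hpp
          rw [DirectSum.of_eq_same, mul_smul, hxt]
        · rw [DirectSum.of_eq_of_ne _ _ _ hpp, smul_zero]
          by_cases h0 : LocalizedModule.mkLinearMap p'.1.asIdeal.primeCompl N x = 0
          · rw [h0, smul_zero]
          · exact hA p' (by simpa using h0) fun h => hpp (Subtype.ext (h.trans hpq.symm))
      · obtain ⟨s, hs, hk⟩ := kill x p hpq
        have hz : s • z = 0 := by
          have h1 : t • (s • z) = 0 := by
            change t.1 • s • z = 0
            rw [smul_comm, hxt, hk]
          exact IsLocalizedModule.smul_injective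
            (LocalizedModule.mkLinearMap p.1.asIdeal.primeCompl N) t (h1.trans (smul_zero t).symm)
        refine ⟨s, hs, ?_⟩
        have : s • DirectSum.of (fun p : 𝓕.boundary i =>
            LocalizedModule p.1.asIdeal.primeCompl N) p z = 0 := by
          rw [← DirectSum.lof_eq_of R, ← map_smul, hz, map_zero]
        rw [this]
        exact zero_mem _
  refine Module.notMem_support_iff'.2 (fun y => ?_) hq
  obtain ⟨y, rfl⟩ := Submodule.mkQ_surjective _ y
  obtain ⟨s, hs, h⟩ := claim y
  refine ⟨s, hs, ?_⟩
  rw [← map_smul]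
  exact (Submodule.Quotient.mk_eq_zero _).2 h

/-- The `i`-th stage in the construction of the Cousin complex: a module, to be thought of as
`coker d^{i-2}`, with support in `F i`. -/
structure Stage (i : ℕ) where
  coker : ModuleCat.{u} R
  support_subset : Module.support R coker ⊆ 𝓕.F i

variable (M : Type u) [AddCommGroup M] [Module R M]

/-- The stages of the Cousin complex: `coker d^{-2} = M` (where `d^{-2} : 0 → M`), and
`coker d^{i-1}` is the cokernel of the localization map
`coker d^{i-2} → M^i = ⨁_{p ∈ ∂F i} (coker d^{i-2})ₚ`. Since `d^{i-1}` is the composite of the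
surjection of `M^{i-1}` onto `coker d^{i-2}` with this localization map, both have the same
cokernel. -/
def stage [IsNoetherianRing R] (hM : Module.support R M ⊆ 𝓕.F 0) : ∀ i, Stage 𝓕 i
  | 0 => ⟨ModuleCat.of R M, hM⟩
  | i + 1 =>
    ⟨ModuleCat.of R (Term (𝓕.boundary i) (stage hM i).coker ⧸
        LinearMap.range (map 𝓕 (stage hM i).support_subset)),
      support_coker_subset 𝓕 (stage hM i).support_subset⟩

/-- The term `M^i = ⨁_{p ∈ ∂F i} (coker d^{i-2})ₚ` of the Cousin complex. -/
def X [IsNoetherianRing R] (hM : Module.support R M ⊆ 𝓕.F 0) (i : ℕ) : ModuleCat.{u} R :=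
  ModuleCat.of R (Term (𝓕.boundary i) (stage 𝓕 M hM i).coker)

/-- The localization map `coker d^{i-2} → M^i`. -/
def ι [IsNoetherianRing R] (hM : Module.support R M ⊆ 𝓕.F 0) (i : ℕ) :
    (stage 𝓕 M hM i).coker →ₗ[R] X 𝓕 M hM i :=
  map 𝓕 (stage 𝓕 M hM i).support_subset

/-- The canonical epimorphism `M^i → coker d^{i-1}`. -/
def π [IsNoetherianRing R] (hM : Module.support R M ⊆ 𝓕.F 0) (i : ℕ) :
    X 𝓕 M hM i →ₗ[R] (stage 𝓕 M hM (i + 1)).coker :=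
  Submodule.mkQ (LinearMap.range (ι 𝓕 M hM i))

/-- The augmentation `d^{-1} : M → M^0`. -/
def ε [IsNoetherianRing R] (hM : Module.support R M ⊆ 𝓕.F 0) : M →ₗ[R] X 𝓕 M hM 0 :=
  ι 𝓕 M hM 0

/-- The differential `d^i : M^i → M^{i+1}`, whose component at `q ∈ ∂F (i + 1)` sends `x` to
`π x / 1`. -/
def d [IsNoetherianRing R] (hM : Module.support R M ⊆ 𝓕.F 0) (i : ℕ) :
    X 𝓕 M hM i →ₗ[R] X 𝓕 M hM (i + 1) :=
  ι 𝓕 M hM (i + 1) ∘ₗ π 𝓕 M hM i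

theorem ε_apply [IsNoetherianRing R] (hM : Module.support R M ⊆ 𝓕.F 0) (m : M)
    (p : 𝓕.boundary 0) :
    (show Term (𝓕.boundary 0) M from ε 𝓕 M hM m) p =
      LocalizedModule.mkLinearMap p.1.asIdeal.primeCompl M m :=
  toTerm_apply _ _ _

theorem d_apply [IsNoetherianRing R] (hM : Module.support R M ⊆ 𝓕.F 0) (i : ℕ)
    (x : X 𝓕 M hM i) (q : 𝓕.boundary (i + 1)) :
    DFunLike.coe (F := Term (𝓕.boundary (i + 1)) (stage 𝓕 M hM (i + 1)).coker)
      (d 𝓕 M hM i x) q =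
      LocalizedModule.mkLinearMap q.1.asIdeal.primeCompl (stage 𝓕 M hM (i + 1)).coker
        (π 𝓕 M hM i x) :=
  toTerm_apply (finite_ne_zero 𝓕 (stage 𝓕 M hM (i + 1)).support_subset) (π 𝓕 M hM i x) q

theorem ker_π_zero [IsNoetherianRing R] (hM : Module.support R M ⊆ 𝓕.F 0) :
    LinearMap.ker (π 𝓕 M hM 0) = LinearMap.range (ε 𝓕 M hM) :=
  Submodule.ker_mkQ _

/-- Thus `π` is, up to isomorphism, the projection of `M^{i+1}` onto the cokernel of `d^i`. -/
theorem ker_π_succ [IsNoetherianRing R] (hM : Module.support R M ⊆ 𝓕.F 0) (i : ℕ) :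
    LinearMap.ker (π 𝓕 M hM (i + 1)) = LinearMap.range (d 𝓕 M hM i) :=
  (Submodule.ker_mkQ _).trans
    (LinearMap.range_comp_of_range_eq_top _
      (LinearMap.range_eq_top.2 (Submodule.mkQ_surjective _))).symm

theorem d_comp_ε [IsNoetherianRing R] (hM : Module.support R M ⊆ 𝓕.F 0) :
    d 𝓕 M hM 0 ∘ₗ ε 𝓕 M hM = 0 := by
  ext x
  have : π 𝓕 M hM 0 (ε 𝓕 M hM x) = 0 := by
    rw [← LinearMap.mem_ker, ker_π_zero]
    exact ⟨x, rfl⟩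
  rw [d, LinearMap.comp_assoc, LinearMap.comp_apply, LinearMap.comp_apply, this, map_zero]
  rfl

theorem d_comp_d [IsNoetherianRing R] (hM : Module.support R M ⊆ 𝓕.F 0) (i : ℕ) :
    d 𝓕 M hM (i + 1) ∘ₗ d 𝓕 M hM i = 0 := by
  refine LinearMap.ext fun x => ?_
  have : π 𝓕 M hM (i + 1) (d 𝓕 M hM i x) = 0 := by
    rw [← LinearMap.mem_ker, ker_π_succ]
    exact ⟨x, rfl⟩
  rw [LinearMap.comp_apply, d, LinearMap.comp_apply, this, map_zero]
  rfl

end Complex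

end Cousin

/-! ### G-Gorenstein modules -/

section GGorenstein

variable (R : Type u) [CommRing R] (M : Type u) [AddCommGroup M] [Module R M]

theorem heightFiltration_admits : Module.support R M ⊆ (heightFiltration R M).F 0 :=
  fun p hp => ⟨hp, by simp⟩

/-- A nonzero finitely generated module `M` over a Noetherian ring is G-Gorenstein if its Cousin
complex with respect to the `M`-height filtration is a Gorenstein injective resolution of `M`. -/
def IsGGorenstein [IsNoetherianRing R] : Prop :=
  Nontrivial M ∧ Module.Finite R M ∧
    IsGorensteinInjectiveResolution (N := M)
      (Cousin.X (heightFiltration R M) M (heightFiltration_admits R M))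
      (Cousin.ε (heightFiltration R M) M (heightFiltration_admits R M))
      (Cousin.d (heightFiltration R M) M (heightFiltration_admits R M))

end GGorenstein

end

/-! ### Supports of `Ext` modules -/

/-! Over a Gorenstein local ring both conditions say that `M` is maximal Cohen–Macaulay. The pivot
is the class `ExtAcyclic` of finitely generated modules with Ext^j(M, R) = 0 for all j > 0; each
condition is shown equivalent to membership in it.

Gorenstein projective modules are acyclic by dimension shifting along the complete resolution.
Conversely, for acyclic `M` a depth count at associated primes shows that functionals separate
points (`ExtAcyclic.exists_ne_zero`). Hence `M` embeds in a finite free module with acyclic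
cokernel, and iterating in both directions gives a complete resolution by finite free modules.

If `M` is acyclic, its depth at each prime q of its support is at least ht q, and the M-height of q
equals ht q. The depth bound makes the Cousin complex exact. The equality of heights gives C(M) ≅
C(R) ⊗ M termwise. The terms of C(R) are injective, because the local injective dimension of the
successive cokernels drops by one at each stage. Finally J ⊗ M is Gorenstein injective for J
injective, by tensoring the complete resolution with J.

If `M` is G-Gorenstein, then Ext^j(N, M^0) = 0 for j > 0 and every cokernel N in C(R), since N has a
finite coresolution by injectives. So maps R → M^0 extend to the zeroth term of C(R), which forces
`M` to have a prime of height zero in its support. Chains from it to the maximal ideal 𝔪 have length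
dim R. Exactness of C(M) then gives Ext^i(R/𝔪, M) = 0 for i < dim R, and this depth bound gives
acyclicity.

Local statements take the form `q ∉ extSupport R j C N`: every class is killed by an element outside
q. No change of ring is made. The local engine is Bass's lemma (`mem_extSupport_of_covBy`) and the
comparison of depth with the top nonvanishing Ext (`notMem_extSupport_of_depth`,
`top_le_add_depth`). -/

section ExtSupport

open CategoryTheory CategoryTheory.Abelian

variable {R : Type u} [CommRing R]

/-- The support of the module `Ext^j(C, N)`. -/
def extSupport (R : Type u) [CommRing R] (j : ℕ) (C N : Type u) [AddCommGroup C] [Module R C]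
    [AddCommGroup N] [Module R N] : Set (PrimeSpectrum R) :=
  Module.support R (Ext (ModuleCat.of R C) (ModuleCat.of R N) j)

/-- Additivity plays no role, only compatibility with scalars, so composition with an Ext class can
be supplied as a plain function. -/
theorem Module.support_subset_union_of_exact {A B C : Type*} [AddCommGroup A] [Module R A]
    [AddCommGroup B] [Module R B] [AddCommGroup C] [Module R C] (f : A → B) (g : B → C)
    (hf : ∀ (r : R) a, f (r • a) = r • f a) (hf0 : f 0 = 0)
    (hg : ∀ (r : R) b, g (r • b) = r • g b)
    (h : ∀ b, g b = 0 → ∃ a, f a = b) :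
    Module.support R B ⊆ Module.support R A ∪ Module.support R C := by
  intro q hq
  by_contra hn
  rw [Set.mem_union, not_or] at hn
  refine Module.notMem_support_iff'.2 (fun b => ?_) hq
  obtain ⟨s, hs, hsb⟩ := Module.notMem_support_iff'.1 hn.2 (g b)
  obtain ⟨a, ha⟩ := h (s • b) (by rw [hg, hsb])
  obtain ⟨t, ht, hta⟩ := Module.notMem_support_iff'.1 hn.1 a
  refine ⟨t * s, fun hts => (q.2.mem_or_mem hts).elim ht hs, ?_⟩
  rw [mul_smul, ← ha, ← hf, hta, hf0]

variable {A B C N : Type u} [AddCommGroup A] [Module R A] [AddCommGroup B] [Module R B]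
  [AddCommGroup C] [Module R C] [AddCommGroup N] [Module R N]

/-- The short exact sequence in `ModuleCat` attached to a short exact sequence of modules. -/
theorem shortExact_of {f : A →ₗ[R] B} {g : B →ₗ[R] C} (hf : Function.Injective f)
    (hfg : Function.Exact f g) (hg : Function.Surjective g) :
    (ModuleCat.shortComplexOfCompEqZero f g hfg.linearMap_comp_eq_zero).ShortExact :=
  ModuleCat.shortComplex_shortExact _ hfg hf hg

section LongExact

variable {f : A →ₗ[R] B} {g : B →ₗ[R] C} (hf : Function.Injective f)
  (hfg : Function.Exact f g) (hg : Function.Surjective g) (X : Type u) [AddCommGroup X] [Module R X]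
  (j : ℕ)

include hf hfg hg

theorem extSupport_cov₂ : extSupport R j X B ⊆ extSupport R j X A ∪ extSupport R j X C := by
  have hS := shortExact_of hf hfg hg
  refine Module.support_subset_union_of_exact
    (fun x => x.comp (Ext.mk₀ (ModuleCat.ofHom f)) (add_zero j))
    (fun x => x.comp (Ext.mk₀ (ModuleCat.ofHom g)) (add_zero j)) (by simp) (by simp) (by simp) ?_
  exact fun x hx => Ext.covariant_sequence_exact₂ (ModuleCat.of R X) hS x hx

theorem extSupport_cov₃ : extSupport R j X C ⊆ extSupport R j X B ∪ extSupport R (j + 1) X A := by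
  have hS := shortExact_of hf hfg hg
  refine Module.support_subset_union_of_exact
    (fun x => x.comp (Ext.mk₀ (ModuleCat.ofHom g)) (add_zero j))
    (fun x => x.comp hS.extClass rfl) (by simp) (by simp) (by simp) ?_
  exact fun x hx => Ext.covariant_sequence_exact₃ (ModuleCat.of R X) hS x rfl hx

theorem extSupport_cov₁ :
    extSupport R (j + 1) X A ⊆ extSupport R j X C ∪ extSupport R (j + 1) X B := by
  have hS := shortExact_of hf hfg hg
  refine Module.support_subset_union_of_exact
    (fun x => x.comp hS.extClass rfl)
    (fun x => x.comp (Ext.mk₀ (ModuleCat.ofHom f)) (add_zero (j + 1)))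
    (by simp) (by simp) (by simp) ?_
  exact fun x hx => Ext.covariant_sequence_exact₁ (ModuleCat.of R X) hS x hx rfl

theorem extSupport_contra₂ : extSupport R j B X ⊆ extSupport R j C X ∪ extSupport R j A X := by
  have hS := shortExact_of hf hfg hg
  refine Module.support_subset_union_of_exact
    (fun x => (Ext.mk₀ (ModuleCat.ofHom g)).comp x (zero_add j))
    (fun x => (Ext.mk₀ (ModuleCat.ofHom f)).comp x (zero_add j)) (by simp) (by simp) (by simp) ?_
  exact fun x hx => Ext.contravariant_sequence_exact₂ hS (ModuleCat.of R X) x hx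

theorem extSupport_contra₁ :
    extSupport R j A X ⊆ extSupport R j B X ∪ extSupport R (j + 1) C X := by
  have hS := shortExact_of hf hfg hg
  refine Module.support_subset_union_of_exact
    (fun x => (Ext.mk₀ (ModuleCat.ofHom f)).comp x (zero_add j))
    (fun x => hS.extClass.comp x (add_comm 1 j)) (by simp) (by simp) (by simp) ?_
  exact fun x hx => Ext.contravariant_sequence_exact₁ hS (ModuleCat.of R X) x _ hx

theorem extSupport_contra₃ :
    extSupport R (j + 1) C X ⊆ extSupport R j A X ∪ extSupport R (j + 1) B X := by
  have hS := shortExact_of hf hfg hg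
  refine Module.support_subset_union_of_exact
    (fun x => hS.extClass.comp x (add_comm 1 j))
    (fun x => (Ext.mk₀ (ModuleCat.ofHom g)).comp x (zero_add (j + 1)))
    (by simp) (by simp) (by simp) ?_
  exact fun x hx => Ext.contravariant_sequence_exact₃ hS (ModuleCat.of R X) x hx _

end LongExact

/-- `Ext⁰` is `Hom`. -/
noncomputable def extZeroEquiv : Ext (ModuleCat.of R C) (ModuleCat.of R N) 0 ≃ₗ[R] (C →ₗ[R] N) :=
  Ext.linearEquiv₀.trans ModuleCat.homLinearEquiv

theorem extSupport_zero : extSupport R 0 C N = Module.support R (C →ₗ[R] N) :=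
  LinearEquiv.support_eq extZeroEquiv

theorem notMem_extSupport_zero {q : PrimeSpectrum R} :
    q ∉ extSupport R 0 C N ↔ ∀ f : C →ₗ[R] N, ∃ s ∉ q.asIdeal, s • f = 0 := by
  rw [extSupport_zero, Module.notMem_support_iff']

theorem extSupport_zero_eq_empty : extSupport R 0 C N = ∅ ↔ ∀ f : C →ₗ[R] N, f = 0 := by
  rw [extSupport_zero, Module.support_eq_empty_iff]
  exact ⟨fun h f => Subsingleton.elim _ _, fun h => ⟨fun f g => (h f).trans (h g).symm⟩⟩

theorem extSupport_eq_empty {j : ℕ} : extSupport R j C N = ∅ ↔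
    ∀ e : Ext (ModuleCat.of R C) (ModuleCat.of R N) j, e = 0 := by
  rw [extSupport, Module.support_eq_empty_iff]
  exact ⟨fun h f => Subsingleton.elim _ _, fun h => ⟨fun f g => (h f).trans (h g).symm⟩⟩

theorem extSupport_of_injective [Module.Injective R N] (j : ℕ) :
    extSupport R (j + 1) C N = ∅ := by
  have := Module.injective_object_of_injective_module R N
  exact extSupport_eq_empty.2 fun e => e.eq_zero_of_injective

theorem extSupport_of_projective [Module.Projective R C] (j : ℕ) :
    extSupport R (j + 1) C N = ∅ := by
  have : Projective (ModuleCat.of R C) := (IsProjective.iff_projective C).1 inferInstance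
  exact extSupport_eq_empty.2 fun e => e.eq_zero_of_projective

theorem smul_ext_eq_zero_of_left {j : ℕ} {s : R} (hs : s ∈ Module.annihilator R C)
    (e : Ext (ModuleCat.of R C) (ModuleCat.of R N) j) : s • e = 0 := by
  have h0 : (s • 𝟙 (ModuleCat.of R C)) = 0 := by
    ext x
    exact Module.mem_annihilator.1 hs x
  rw [← Ext.mk₀_id_comp e, ← Ext.smul_comp, ← Ext.mk₀_smul, h0, Ext.mk₀_zero, Ext.zero_comp]

theorem smul_ext_eq_zero_of_right {j : ℕ} {s : R} (hs : s ∈ Module.annihilator R N)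
    (e : Ext (ModuleCat.of R C) (ModuleCat.of R N) j) : s • e = 0 := by
  have h0 : (s • 𝟙 (ModuleCat.of R N)) = 0 := by
    ext x
    exact Module.mem_annihilator.1 hs x
  rw [Ext.smul_eq_comp_mk₀, h0, Ext.mk₀_zero, Ext.comp_zero]

theorem exists_mem_annihilator_of_notMem_support [Module.Finite R C] {q : PrimeSpectrum R}
    (hq : q ∉ Module.support R C) : ∃ s ∈ Module.annihilator R C, s ∉ q.asIdeal := by
  rw [Module.mem_support_iff_of_finite] at hq
  exact SetLike.not_le_iff_exists.1 hq

theorem extSupport_subset_left [Module.Finite R C] (j : ℕ) :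
    extSupport R j C N ⊆ Module.support R C := by
  intro q hq
  by_contra h
  obtain ⟨s, hs, hsq⟩ := exists_mem_annihilator_of_notMem_support h
  exact Module.notMem_support_iff'.2 (fun e => ⟨s, hsq, smul_ext_eq_zero_of_left hs e⟩) hq

theorem extSupport_subset_right [Module.Finite R N] (j : ℕ) :
    extSupport R j C N ⊆ Module.support R N := by
  intro q hq
  by_contra h
  obtain ⟨s, hs, hsq⟩ := exists_mem_annihilator_of_notMem_support h
  exact Module.notMem_support_iff'.2 (fun e => ⟨s, hsq, smul_ext_eq_zero_of_right hs e⟩) hq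

/-- If `s` kills `C` and acts bijectively on `N`, then all `Ext^j(C, N)` vanish. -/
theorem extSupport_of_bijective {s : R} (hs : s ∈ Module.annihilator R C)
    (hN : Function.Bijective (s • (LinearMap.id : N →ₗ[R] N))) (j : ℕ) :
    extSupport R j C N = ∅ := by
  refine extSupport_eq_empty.2 fun e => ?_
  let φ := LinearEquiv.ofBijective _ hN
  have h1 : (s • 𝟙 (ModuleCat.of R N)) ≫ ModuleCat.ofHom φ.symm.toLinearMap = 𝟙 _ := by
    ext x
    exact φ.symm_apply_apply x
  have h2 := smul_ext_eq_zero_of_left hs e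
  rw [Ext.smul_eq_comp_mk₀] at h2
  have h3 : (e.comp (Ext.mk₀ (s • 𝟙 (ModuleCat.of R N))) (add_zero j)).comp
      (Ext.mk₀ (ModuleCat.ofHom φ.symm.toLinearMap)) (add_zero j) = e := by
    rw [Ext.comp_assoc_of_second_deg_zero, Ext.mk₀_comp_mk₀, h1, Ext.comp_mk₀_id]
  rw [← h3, h2, Ext.zero_comp]

theorem extSupport_congr_right {N' : Type u} [AddCommGroup N'] [Module R N'] (e : N ≃ₗ[R] N')
    (j : ℕ) : extSupport R j C N = extSupport R j C N' := by
  have key : ∀ {N N' : Type u} [AddCommGroup N] [Module R N] [AddCommGroup N'] [Module R N']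
      (e : N ≃ₗ[R] N'), extSupport R j C N ⊆ extSupport R j C N' := by
    intro N N' _ _ _ _ e q hq
    have h := extSupport_cov₂ (A := N') (B := N) (C := PUnit.{u + 1}) (f := e.symm.toLinearMap)
      (g := (0 : N →ₗ[R] PUnit.{u + 1})) e.symm.injective
      (fun x => ⟨fun _ => ⟨e x, by simp⟩, fun _ => rfl⟩) (fun x => ⟨0, Subsingleton.elim _ _⟩) C j hq
    refine h.resolve_right fun h' => ?_
    have := extSupport_subset_right j h'
    rwa [Module.support_eq_empty] at this
  exact (key e).antisymm (key e.symm)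

theorem extSupport_congr_left {C' : Type u} [AddCommGroup C'] [Module R C'] (e : C ≃ₗ[R] C')
    (j : ℕ) : extSupport R j C N = extSupport R j C' N := by
  have key : ∀ {C C' : Type u} [AddCommGroup C] [Module R C] [AddCommGroup C'] [Module R C']
      (e : C ≃ₗ[R] C'), extSupport R j C N ⊆ extSupport R j C' N := by
    intro C C' _ _ _ _ e q hq
    have h := extSupport_contra₂ (A := PUnit.{u + 1}) (B := C) (C := C') (g := e.toLinearMap)
      (f := (0 : PUnit.{u + 1} →ₗ[R] C)) (fun x y _ => Subsingleton.elim _ _)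
      (fun x => ⟨fun h => ⟨0, by simpa using (e.map_eq_zero_iff.1 h).symm⟩,
        by rintro ⟨y, rfl⟩; simp⟩)
      e.surjective N j hq
    refine h.resolve_right fun h' => ?_
    have := extSupport_subset_left j h'
    rwa [Module.support_eq_empty] at this
  exact (key e).antisymm (key e.symm)

section Lifting

variable {f : A →ₗ[R] B} {g : B →ₗ[R] C} (hf : Function.Injective f)
  (hfg : Function.Exact f g) (hg : Function.Surjective g)

include hf hfg hg

omit hf hfg in
theorem extSupport_zero_subset_of_surjective (X : Type u) [AddCommGroup X] [Module R X] :
    extSupport R 0 C X ⊆ extSupport R 0 B X := by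
  rw [extSupport_zero, extSupport_zero]
  refine Module.support_subset_of_injective (LinearMap.lcomp R X g) fun u v huv => ?_
  ext c
  obtain ⟨b, rfl⟩ := hg c
  exact LinearMap.congr_fun huv b

/-- The obstruction to extending `φ` is its connecting class in Ext¹(C, N). Away from the support
some s ∉ q kills this class, so s • φ extends. -/
theorem exists_smul_extension {q : PrimeSpectrum R} (hq : q ∉ extSupport R 1 C N)
    (φ : A →ₗ[R] N) : ∃ s ∉ q.asIdeal, ∃ ψ : B →ₗ[R] N, ψ ∘ₗ f = s • φ := by
  have hS := shortExact_of hf hfg hg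
  obtain ⟨s, hs, h⟩ := Module.notMem_support_iff'.1 hq
    (hS.extClass.comp (Ext.mk₀ (ModuleCat.ofHom φ)) (add_zero 1))
  refine ⟨s, hs, ?_⟩
  obtain ⟨x, hx⟩ := Ext.contravariant_sequence_exact₁ hS (ModuleCat.of R N)
    (s • Ext.mk₀ (ModuleCat.ofHom φ)) (add_zero 1) (by rw [Ext.comp_smul]; exact h)
  obtain ⟨ψ, rfl⟩ := (Ext.mk₀_bijective _ _).2 x
  refine ⟨ψ.hom, ?_⟩
  rw [Ext.mk₀_comp_mk₀, ← Ext.mk₀_smul] at hx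
  have := (Ext.mk₀_bijective _ _).1 hx
  exact congrArg ModuleCat.Hom.hom this

theorem exists_extension (h : extSupport R 1 C N = ∅) (φ : A →ₗ[R] N) :
    ∃ ψ : B →ₗ[R] N, ψ ∘ₗ f = φ := by
  have hS := shortExact_of hf hfg hg
  obtain ⟨x, hx⟩ := Ext.contravariant_sequence_exact₁ hS (ModuleCat.of R N)
    (Ext.mk₀ (ModuleCat.ofHom φ)) (add_zero 1) (extSupport_eq_empty.1 h _)
  obtain ⟨ψ, rfl⟩ := (Ext.mk₀_bijective _ _).2 x
  refine ⟨ψ.hom, ?_⟩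
  rw [Ext.mk₀_comp_mk₀] at hx
  exact congrArg ModuleCat.Hom.hom ((Ext.mk₀_bijective _ _).1 hx)

/-- When Ext¹(B, N) = 0, every class in Ext¹(C, N) is the connecting image of some map A → N, and
that image vanishes once the map extends to B. -/
theorem extSupport_one_of_extension (hB : extSupport R 1 B N = ∅)
    (h : ∀ φ : A →ₗ[R] N, ∃ ψ : B →ₗ[R] N, ψ ∘ₗ f = φ) : extSupport R 1 C N = ∅ := by
  have hS := shortExact_of hf hfg hg
  refine extSupport_eq_empty.2 fun e => ?_
  obtain ⟨x, rfl⟩ := Ext.contravariant_sequence_exact₃ hS (ModuleCat.of R N) e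
    (extSupport_eq_empty.1 hB _) (add_zero 1)
  obtain ⟨φ, rfl⟩ := (Ext.mk₀_bijective _ _).2 x
  obtain ⟨ψ, hψ⟩ := h φ.hom
  have : φ = ModuleCat.ofHom f ≫ ModuleCat.ofHom ψ := by
    ext x
    exact (LinearMap.congr_fun hψ x).symm
  rw [this, ← Ext.mk₀_comp_mk₀]
  exact hS.extClass_comp_assoc _

theorem extSupport_one_of_lift (hB : extSupport R 1 N B = ∅)
    (h : ∀ φ : N →ₗ[R] C, ∃ ψ : N →ₗ[R] B, g ∘ₗ ψ = φ) : extSupport R 1 N A = ∅ := by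
  have hS := shortExact_of hf hfg hg
  refine extSupport_eq_empty.2 fun e => ?_
  obtain ⟨x, rfl⟩ := Ext.covariant_sequence_exact₁ (ModuleCat.of R N) hS e
    (extSupport_eq_empty.1 hB _) (zero_add 1)
  obtain ⟨φ, rfl⟩ := (Ext.mk₀_bijective _ _).2 x
  obtain ⟨ψ, hψ⟩ := h φ.hom
  have : φ = ModuleCat.ofHom ψ ≫ ModuleCat.ofHom g := by
    ext x
    exact (LinearMap.congr_fun hψ x).symm
  rw [this, ← Ext.mk₀_comp_mk₀, Ext.comp_assoc_of_second_deg_zero]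
  erw [hS.comp_extClass]
  rw [Ext.comp_zero]

end Lifting

end ExtSupport

/-! ### Ext out of finitely generated modules: direct sums, localization, Nakayama, prime
filtrations. -/

section ExtFinite

variable {R : Type u} [CommRing R] [IsNoetherianRing R]
variable {C N : Type u} [AddCommGroup C] [Module R C] [AddCommGroup N] [Module R N]

omit [IsNoetherianRing R] in
variable (R) in
/-- A finitely generated module is the quotient of a finite free module. -/
theorem exists_surjective_fin (C : Type u) [AddCommGroup C] [Module R C] [Module.Finite R C] :
    ∃ (n : ℕ) (π : (Fin n → R) →ₗ[R] C), Function.Surjective π :=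
  Module.Finite.exists_fin' R C

omit [IsNoetherianRing R] in
theorem extSupport_succ_succ {n : ℕ} {π : (Fin n → R) →ₗ[R] C} (hπ : Function.Surjective π)
    (j : ℕ) : extSupport R (j + 2) C N = extSupport R (j + 1) (LinearMap.ker π) N := by
  have hex := LinearMap.exact_subtype_ker_map π
  have hinj := (LinearMap.ker π).injective_subtype
  apply Set.Subset.antisymm
  · intro q hq
    have := extSupport_contra₃ hinj hex hπ N (j + 1) hq
    rwa [extSupport_of_projective (C := Fin n → R), Set.union_empty] at this
  · intro q hq
    have := extSupport_contra₁ hinj hex hπ N (j + 1) hq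
    rwa [extSupport_of_projective (C := Fin n → R), Set.empty_union] at this

/-- In degree one, a map from the finitely generated first syzygy meets only finitely many summands,
so the extensions of its components can be summed. Higher degrees follow by dimension shifting. -/
theorem extSupport_directSum {ι : Type u} {X : ι → Type u} [∀ p, AddCommGroup (X p)]
    [∀ p, Module R (X p)] (j : ℕ) : ∀ (C : Type u) [AddCommGroup C] [Module R C]
    [Module.Finite R C], (∀ p, extSupport R j C (X p) = ∅) →
      extSupport R j C (⨁ p, X p) = ∅ := by
  classical
  match j with
  | 0 =>
    intro C _ _ _ h
    refine extSupport_zero_eq_empty.2 fun f => LinearMap.ext fun c => DFinsupp.ext fun p => ?_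
    exact LinearMap.congr_fun (extSupport_zero_eq_empty.1 (h p)
      (DirectSum.component R ι X p ∘ₗ f)) c
  | 1 =>
    intro C _ _ _ h
    obtain ⟨n, π, hπ⟩ := exists_surjective_fin R C
    have hex := LinearMap.exact_subtype_ker_map π
    have hinj := (LinearMap.ker π).injective_subtype
    refine extSupport_one_of_extension hinj hex hπ (extSupport_of_projective 0) fun φ => ?_
    have hA : ∃ A : Finset ι, ∀ x, ∀ p ∉ A, φ x p = 0 := by
      obtain ⟨s, hs⟩ := (Module.Finite.fg_top : (⊤ : Submodule R (LinearMap.ker π)).FG)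
      refine ⟨s.biUnion fun x => (φ x).support, fun x p hp => ?_⟩
      have hx : x ∈ Submodule.span R (s : Set (LinearMap.ker π)) := hs ▸ Submodule.mem_top
      induction hx using Submodule.span_induction with
      | mem x hx =>
        by_contra h0
        exact hp (Finset.mem_biUnion.2 ⟨x, hx, DFinsupp.mem_support_iff.2 h0⟩)
      | zero => simp
      | add x y _ _ hx hy => rw [map_add, DirectSum.add_apply, hx, hy, add_zero]
      | smul r x _ hx => rw [map_smul, DirectSum.smul_apply, hx, smul_zero]
    obtain ⟨A, hA⟩ := hA
    choose ψ hψ using fun p => exists_extension hinj hex hπ (h p) (DirectSum.component R ι X p ∘ₗ φ)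
    refine ⟨∑ p ∈ A, DirectSum.lof R ι X p ∘ₗ ψ p, LinearMap.ext fun x => ?_⟩
    refine DFinsupp.ext fun p => ?_
    have h1 : ∀ p, ψ p x = φ x p := fun p => LinearMap.congr_fun (hψ p) x
    rw [LinearMap.comp_apply, LinearMap.sum_apply]
    simp only [LinearMap.comp_apply, Submodule.subtype_apply, h1]
    rw [DFinsupp.finsetSum_apply]
    by_cases hp : p ∈ A
    · rw [Finset.sum_eq_single p]
      · exact DirectSum.lof_apply R p _
      · exact fun p' _ hne => DirectSum.of_eq_of_ne _ _ _ hne.symm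
      · exact fun h => absurd hp h
    · rw [hA x p hp]
      refine Finset.sum_eq_zero fun p' hp' => DirectSum.of_eq_of_ne _ _ _ ?_
      rintro rfl
      exact hp hp'
  | j + 2 =>
    intro C _ _ _ h
    obtain ⟨n, π, hπ⟩ := exists_surjective_fin R C
    rw [extSupport_succ_succ hπ]
    exact extSupport_directSum (j + 1) _ fun p => by rw [← extSupport_succ_succ hπ, h p]

omit [IsNoetherianRing R] in
theorem LocalizedModule.bijective_smul (q : PrimeSpectrum R) (N : Type u) [AddCommGroup N]
    [Module R N] {s : R} (hs : s ∉ q.asIdeal) : Function.Bijective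
      (s • (LinearMap.id : LocalizedModule q.asIdeal.primeCompl N →ₗ[R] _)) := by
  have := IsLocalizedModule.map_units (LocalizedModule.mkLinearMap q.asIdeal.primeCompl N)
    (⟨s, hs⟩ : q.asIdeal.primeCompl)
  exact (Module.End.isUnit_iff _).1 this

/-- A map from the finitely presented syzygy to N_q lifts to N after multiplication by some s ∉ q,
and the lift extends after multiplication by some t ∉ q. Since ts is invertible on N_q, dividing by
it extends the original map. -/
theorem extSupport_one_localizedModule [Module.Finite R C] {q : PrimeSpectrum R}
    (hq : q ∉ extSupport R 1 C N) :
    extSupport R 1 C (LocalizedModule q.asIdeal.primeCompl N) = ∅ := by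
  obtain ⟨n, π, hπ⟩ := exists_surjective_fin R C
  have hex := LinearMap.exact_subtype_ker_map π
  have hinj := (LinearMap.ker π).injective_subtype
  refine extSupport_one_of_extension hinj hex hπ (extSupport_of_projective 0) fun φ => ?_
  have : Module.FinitePresentation R (LinearMap.ker π) :=
    Module.finitePresentation_of_finite R _
  obtain ⟨φ', s, hφ'⟩ := Module.FinitePresentation.exists_lift_of_isLocalizedModule
    q.asIdeal.primeCompl (LocalizedModule.mkLinearMap q.asIdeal.primeCompl N) φ
  obtain ⟨t, ht, ψ, hψ⟩ := exists_smul_extension hinj hex hπ hq φ'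
  have hts : t * s.1 ∉ q.asIdeal := fun h => (q.2.mem_or_mem h).elim ht s.2
  let e := LinearEquiv.ofBijective _ (LocalizedModule.bijective_smul q N hts)
  refine ⟨e.symm.toLinearMap ∘ₗ LocalizedModule.mkLinearMap q.asIdeal.primeCompl N ∘ₗ ψ,
    LinearMap.ext fun x => ?_⟩
  have h1 : ψ x = t • φ' x := LinearMap.congr_fun hψ x
  have h2 : LocalizedModule.mkLinearMap q.asIdeal.primeCompl N (φ' x) = s.1 • φ x :=
    LinearMap.congr_fun hφ' x
  refine e.injective ?_
  change e (e.symm _) = (t * s.1) • φ x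
  rw [LinearEquiv.apply_symm_apply]
  change LocalizedModule.mkLinearMap q.asIdeal.primeCompl N (ψ x) = _
  rw [h1, map_smul, h2, mul_smul]

omit [IsNoetherianRing R] in
theorem smul_exact_mkQ (x : R) (hx : IsSMulRegular C x) :
    Function.Injective (x • (LinearMap.id : C →ₗ[R] C)) ∧
    Function.Exact (x • (LinearMap.id : C →ₗ[R] C))
      (LinearMap.range (x • (LinearMap.id : C →ₗ[R] C))).mkQ ∧
    Function.Surjective (LinearMap.range (x • (LinearMap.id : C →ₗ[R] C))).mkQ :=
  ⟨hx, LinearMap.exact_map_mkQ_range _, Submodule.mkQ_surjective _⟩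

open CategoryTheory CategoryTheory.Abelian in
/-- A form of Nakayama's lemma for `Ext`. -/
theorem notMem_extSupport_of_succ [Module.Finite R C] [Module.Finite R N] {q : PrimeSpectrum R}
    {x : R} (hxq : x ∈ q.asIdeal) (hx : IsSMulRegular C x) {j : ℕ}
    (h : q ∉ extSupport R (j + 1) (C ⧸ LinearMap.range (x • (LinearMap.id : C →ₗ[R] C))) N) :
    q ∉ extSupport R j C N := by
  obtain ⟨hf, hfg, hg⟩ := smul_exact_mkQ x hx
  have hS := shortExact_of hf hfg hg
  intro hq
  let E := Ext (ModuleCat.of R C) (ModuleCat.of R N) j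
  -- Nakayama for the finitely generated E: since x ∈ q, E_q ≠ 0 implies (E/xE)_q ≠ 0. The
  -- hypothesis contradicts this, because the connecting map makes every class divisible by x after
  -- multiplication by an element outside q.
  have h1 : q ∈ Module.support R (QuotSMulTop x E) := by
    rw [Module.support_quotSMulTop]
    exact ⟨hq, by simpa using hxq⟩
  refine Module.notMem_support_iff'.2 (fun b => ?_) h1
  obtain ⟨e, rfl⟩ := Submodule.mkQ_surjective _ b
  obtain ⟨s, hs, hse⟩ := Module.notMem_support_iff'.1 h (hS.extClass.comp e (add_comm 1 j))
  refine ⟨s, hs, ?_⟩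
  obtain ⟨y, hy⟩ := Ext.contravariant_sequence_exact₁ hS (ModuleCat.of R N) (s • e)
    (add_comm 1 j) (by rw [Ext.comp_smul]; exact hse)
  rw [← map_smul, Submodule.mkQ_apply, Submodule.Quotient.mk_eq_zero]
  have h2 : x • y = s • e := by
    rw [← hy]
    have : (ModuleCat.shortComplexOfCompEqZero _ _ hfg.linearMap_comp_eq_zero).f =
      x • 𝟙 (ModuleCat.of R C) := rfl
    rw [this, Ext.mk₀_smul, Ext.smul_comp, Ext.mk₀_id_comp]
  rw [← h2]
  exact Submodule.smul_mem_pointwise_smul _ _ _ Submodule.mem_top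

omit [IsNoetherianRing R] in
open CategoryTheory CategoryTheory.Abelian in
/-- Dividing by a regular element killing `C` lowers the indices of nonvanishing `Ext`. -/
theorem extSupport_succ_subset_of_regular {x : R} (hC : x ∈ Module.annihilator R C)
    (hx : IsSMulRegular N x) (j : ℕ) : extSupport R (j + 1) C N ⊆
      extSupport R j C (N ⧸ LinearMap.range (x • (LinearMap.id : N →ₗ[R] N))) := by
  obtain ⟨hf, hfg, hg⟩ := smul_exact_mkQ x hx
  have hS := shortExact_of hf hfg hg
  refine Module.support_subset_of_surjective
    (hS.extClass.postcompOfLinear R (ModuleCat.of R C) rfl) fun e => ?_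
  refine Ext.covariant_sequence_exact₁ _ hS e ?_ rfl
  have : (ModuleCat.shortComplexOfCompEqZero _ _ hfg.linearMap_comp_eq_zero).f =
      x • 𝟙 (ModuleCat.of R N) := rfl
  rw [this, ← Ext.smul_eq_comp_mk₀, smul_ext_eq_zero_of_left hC]

/-- A locus avoided by the modules `Ext^j(R/p, N)` is avoided by all `Ext^j(C, N)`. -/
theorem notMem_extSupport_of_primes {q : PrimeSpectrum R} {j : ℕ} [Module.Finite R C]
    (h : ∀ p : PrimeSpectrum R, p ∈ Module.support R C →
      q ∉ extSupport R j (R ⧸ p.asIdeal) N) : q ∉ extSupport R j C N := by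
  revert h
  induction (inferInstance : Module.Finite R C) using
    IsNoetherianRing.induction_on_isQuotientEquivQuotientPrime R with
  | subsingleton C =>
    intro _ hq
    have := extSupport_subset_left j hq
    rwa [Module.support_eq_empty] at this
  | quotient C p e =>
    intro h
    rw [extSupport_congr_left e]
    refine h p ?_
    rw [e.support_eq, Module.mem_support_iff_of_finite, Ideal.annihilator_quotient]
  | exact A B C f g hf hg hfg hA hC =>
    intro h hq
    have hsup := Module.support_of_exact hfg hf hg
    rcases extSupport_contra₂ hf hfg hg N j hq with hq | hq
    · exact hC (fun p hp => h p (hsup ▸ Or.inr hp)) hq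
    · exact hA (fun p hp => h p (hsup ▸ Or.inl hp)) hq

end ExtFinite

/-! ### Bass's lemma, and depth versus top nonvanishing Ext at a prime. -/

section LocalExt

variable {R : Type u} [CommRing R] [IsNoetherianRing R]
variable {C N : Type u} [AddCommGroup C] [Module R C] [AddCommGroup N] [Module R N]

/-- The quotient of `C` by `x C`, as the cokernel of multiplication by `x`. -/
abbrev QuotByElt (x : R) (C : Type u) [AddCommGroup C] [Module R C] : Type u :=
  C ⧸ LinearMap.range (x • (LinearMap.id : C →ₗ[R] C))

omit [IsNoetherianRing R] in
theorem mem_annihilator_quotByElt (x : R) : x ∈ Module.annihilator R (QuotByElt x C) := by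
  refine Module.mem_annihilator.2 fun c => ?_
  obtain ⟨c, rfl⟩ := Submodule.mkQ_surjective _ c
  rw [← map_smul, Submodule.mkQ_apply, Submodule.Quotient.mk_eq_zero]
  exact ⟨c, rfl⟩

omit [IsNoetherianRing R] in
theorem mem_of_mem_support_quotByElt {x : R} {p : PrimeSpectrum R}
    (hp : p ∈ Module.support R (QuotByElt x C)) : x ∈ p.asIdeal :=
  Module.annihilator_le_of_mem_support hp (mem_annihilator_quotByElt x)

omit [IsNoetherianRing R] in
theorem mem_support_quotient_prime {p q : PrimeSpectrum R} :
    q ∈ Module.support R (R ⧸ p.asIdeal) ↔ p ≤ q := by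
  rw [Module.mem_support_iff_of_finite, Ideal.annihilator_quotient]
  rfl

omit [IsNoetherianRing R] in
theorem le_of_mem_extSupport {p q : PrimeSpectrum R} {j : ℕ}
    (h : q ∈ extSupport R j (R ⧸ p.asIdeal) N) : p ≤ q :=
  mem_support_quotient_prime.1 (extSupport_subset_left j h)

omit [IsNoetherianRing R] in
theorem isSMulRegular_quotient_prime {p : PrimeSpectrum R} {x : R} (hx : x ∉ p.asIdeal) :
    IsSMulRegular (R ⧸ p.asIdeal) x := by
  refine (isSMulRegular_iff_right_eq_zero_of_smul (r := x)).2 fun c hc => ?_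
  obtain ⟨c, rfl⟩ := Ideal.Quotient.mk_surjective c
  rw [Ideal.Quotient.eq_zero_iff_mem]
  have h : Ideal.Quotient.mk p.asIdeal (x * c) = 0 := by
    rw [map_mul]
    simpa [Algebra.smul_def] using hc
  exact (p.2.mem_or_mem (Ideal.Quotient.eq_zero_iff_mem.1 h)).resolve_left hx

/-- Nonvanishing of local `Ext` modules propagates along immediate specializations. -/
theorem mem_extSupport_of_covBy [Module.Finite R N] {p q : PrimeSpectrum R} (hpq : p ⋖ q) {j : ℕ}
    (h : p ∈ extSupport R j (R ⧸ p.asIdeal) N) : q ∈ extSupport R (j + 1) (R ⧸ q.asIdeal) N := by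
  by_contra hq
  obtain ⟨x, hxq, hxp⟩ := SetLike.not_le_iff_exists.1 (show ¬ q.asIdeal ≤ p.asIdeal from hpq.1.not_ge)
  -- Primes in the support of (R/p)/x strictly contain p, so the only one below q is q itself.
  refine notMem_extSupport_of_succ hxq (isSMulRegular_quotient_prime hxp)
    (notMem_extSupport_of_primes fun p' hp' hq' => ?_) (Module.mem_support_mono hpq.1.le h)
  have h1 : p ≤ p' := mem_support_quotient_prime.1
    (Module.support_subset_of_surjective (Submodule.mkQ _) (Submodule.mkQ_surjective _) hp')
  have h2 : p' ≤ q := le_of_mem_extSupport hq'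
  have h3 : p ≠ p' := fun h => hxp (h ▸ mem_of_mem_support_quotByElt hp')
  rcases hpq.eq_or_eq h1 h2 with h | h
  · exact h3 h.symm
  · subst h
    exact hq hq'

/-- Let `m` be the largest index with some `Ext^m(C, N)_q ≠ 0`; then `Ext^m(R/q, N)_q ≠ 0`. -/
theorem exists_top_extSupport [Module.Finite R N] {n : ℕ}
    (hn : ∀ (C : Type u) [AddCommGroup C] [Module R C] [Module.Finite R C] (j : ℕ), n < j →
      extSupport R j C N = ∅) {q : PrimeSpectrum R} (hq : q ∈ Module.support R N) :
    ∃ m, q ∈ extSupport R m (R ⧸ q.asIdeal) N ∧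
      ∀ (C : Type u) [AddCommGroup C] [Module R C] [Module.Finite R C] (j : ℕ), m < j →
        q ∉ extSupport R j C N := by
  classical
  let P : ℕ → Prop := fun j => ∃ C : ModuleCat.{u} R, Module.Finite R C ∧ q ∈ extSupport R j C N
  have hP0 : P 0 := by
    refine ⟨ModuleCat.of R R, inferInstanceAs (Module.Finite R R), ?_⟩
    rw [extSupport_zero, LinearEquiv.support_eq (LinearMap.ringLmapEquivSelf R R N)]
    exact hq
  have hPm : P (Nat.findGreatest P n) := Nat.findGreatest_spec (Nat.zero_le n) hP0
  have htop : ∀ (C : Type u) [AddCommGroup C] [Module R C] [Module.Finite R C] (j : ℕ),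
      Nat.findGreatest P n < j → q ∉ extSupport R j C N := by
    intro C _ _ _ j hj hqj
    rcases le_or_gt j n with hjn | hjn
    · exact Nat.findGreatest_is_greatest hj hjn ⟨ModuleCat.of R C, ‹_›, hqj⟩
    · exact (hn C j hjn ▸ hqj : q ∈ (∅ : Set _))
  refine ⟨Nat.findGreatest P n, ?_, htop⟩
  obtain ⟨C, hC, hqC⟩ := hPm
  by_contra hnot
  refine notMem_extSupport_of_primes (fun p _ hp => ?_) hqC
  have hle : p ≤ q := le_of_mem_extSupport hp
  by_cases hpq : p = q
  · subst hpq
    exact hnot hp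
  obtain ⟨x, hxq, hxp⟩ := SetLike.not_le_iff_exists.1
    (show ¬ q.asIdeal ≤ p.asIdeal from fun h => hpq (le_antisymm hle h))
  -- For p < q, Nakayama and the vanishing in degree m + 1 kill Ext^m(R/p, N) at q, so only R/q can
  -- account for the nonvanishing in degree m.
  exact notMem_extSupport_of_succ hxq (isSMulRegular_quotient_prime hxp)
    (htop _ _ (Nat.lt_succ_self _)) hp

omit [IsNoetherianRing R] in
theorem mem_extSupport_zero_of_injective {q : PrimeSpectrum R} {f : (R ⧸ q.asIdeal) →ₗ[R] C}
    (hf : Function.Injective f) : q ∈ extSupport R 0 (R ⧸ q.asIdeal) C := by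
  by_contra h
  obtain ⟨s, hs, hsf⟩ := notMem_extSupport_zero.1 h f
  have h1 : f (s • Ideal.Quotient.mk q.asIdeal 1) = f 0 := by
    rw [map_smul, map_zero]
    exact LinearMap.congr_fun hsf _
  have h2 := hf h1
  rw [← Ideal.Quotient.mk_eq_mk, ← Submodule.Quotient.mk_smul, Submodule.Quotient.mk_eq_zero,
    smul_eq_mul, mul_one] at h2
  exact hs h2

omit [IsNoetherianRing R] in
theorem exists_injective_of_mem_extSupport_zero {q : PrimeSpectrum R}
    (h : q ∈ extSupport R 0 (R ⧸ q.asIdeal) C) :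
    ∃ f : (R ⧸ q.asIdeal) →ₗ[R] C, Function.Injective f := by
  by_contra hn
  push Not at hn
  refine notMem_extSupport_zero.2 (fun f => ?_) h
  have := hn f
  rw [injective_iff_map_eq_zero] at this
  push Not at this
  obtain ⟨a, ha, ha0⟩ := this
  obtain ⟨s, rfl⟩ := Ideal.Quotient.mk_surjective a
  refine ⟨s, fun hs => ha0 (Ideal.Quotient.eq_zero_iff_mem.2 hs), ?_⟩
  ext
  simp only [LinearMap.comp_apply, LinearMap.smul_apply, LinearMap.zero_apply]
  rw [← map_smul]
  convert ha using 2
  change Submodule.Quotient.mk (s • (1 : R)) = _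
  rw [smul_eq_mul, mul_one]
  rfl

/-- The submodule of the elements killed by some element outside of `q`. -/
def primeTorsion (q : PrimeSpectrum R) (C : Type u) [AddCommGroup C] [Module R C] :
    Submodule R C where
  carrier := {c | ∃ s ∉ q.asIdeal, s • c = 0}
  zero_mem' := ⟨1, fun h => q.2.ne_top ((Ideal.eq_top_iff_one _).2 h), smul_zero _⟩
  add_mem' := by
    rintro a b ⟨s, hs, hsa⟩ ⟨t, ht, htb⟩
    refine ⟨s * t, fun h => (q.2.mem_or_mem h).elim hs ht, ?_⟩
    rw [smul_add, mul_smul s t b, htb, smul_zero, mul_comm, mul_smul, hsa, smul_zero, add_zero]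
  smul_mem' := by
    rintro r a ⟨s, hs, hsa⟩
    exact ⟨s, hs, by rw [smul_comm, hsa, smul_zero]⟩

omit [IsNoetherianRing R] in
theorem notMem_support_primeTorsion (q : PrimeSpectrum R) :
    q ∉ Module.support R (primeTorsion q C) :=
  Module.notMem_support_iff'.2 fun ⟨_, s, hs, h⟩ => ⟨s, hs, Subtype.ext h⟩

omit [IsNoetherianRing R] in
theorem isSMulRegular_quotient_primeTorsion {q : PrimeSpectrum R} {s : R} (hs : s ∉ q.asIdeal) :
    IsSMulRegular (C ⧸ primeTorsion q C) s := by
  refine (isSMulRegular_iff_right_eq_zero_of_smul (r := s)).2 fun c hc => ?_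
  obtain ⟨c, rfl⟩ := Submodule.mkQ_surjective _ c
  rw [← map_smul, Submodule.mkQ_apply, Submodule.Quotient.mk_eq_zero] at hc
  obtain ⟨t, ht, htc⟩ := hc
  rw [Submodule.mkQ_apply, Submodule.Quotient.mk_eq_zero]
  exact ⟨t * s, fun h => (q.2.mem_or_mem h).elim ht hs, by rw [mul_smul, htc]⟩

/-- Elements outside q are regular on the quotient, so its associated primes lie in q. If q
consisted of zero divisors, prime avoidance would make q itself associated, embedding R/q in the
quotient. -/
theorem exists_regular_quotient_primeTorsion [Module.Finite R C] {q : PrimeSpectrum R}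
    (h : q ∉ extSupport R 0 (R ⧸ q.asIdeal) (C ⧸ primeTorsion q C)) :
    ∃ x ∈ q.asIdeal, IsSMulRegular (C ⧸ primeTorsion q C) x := by
  by_contra hn
  push Not at hn
  have hsub : (q.asIdeal : Set R) ⊆ ⋃ p ∈ associatedPrimes R (C ⧸ primeTorsion q C), (p : Set R) := by
    rw [biUnion_associatedPrimes_eq_zero_divisors]
    intro x hx
    have := hn x hx
    rw [isSMulRegular_iff_right_eq_zero_of_smul] at this
    push Not at this
    obtain ⟨c, hc, hc0⟩ := this
    exact ⟨c, hc0, hc⟩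
  obtain ⟨p, hp, hqp⟩ := (Ideal.subset_union_prime_finite
    (associatedPrimes.finite R (C ⧸ primeTorsion q C)) (f := id) ⊥ ⊥
    (fun i hi _ _ => hi.isPrime)).1 hsub
  obtain ⟨hprime, f, hf⟩ := (isAssociatedPrime_iff_exists_injective_linearMap _ _).1 hp
  have hpq : p ≤ q.asIdeal := by
    intro s hs
    by_contra hsq
    have h1 : s • f (Ideal.Quotient.mk p 1) = 0 := by
      rw [← map_smul]
      have : s • Ideal.Quotient.mk p 1 = 0 := by
        rw [← Ideal.Quotient.mk_eq_mk, ← Submodule.Quotient.mk_smul,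
          Submodule.Quotient.mk_eq_zero, smul_eq_mul, mul_one]
        exact hs
      rw [this, map_zero]
    have h2 := (isSMulRegular_iff_right_eq_zero_of_smul (r := s)).1
      (isSMulRegular_quotient_primeTorsion hsq) _ h1
    have h3 := hf (h2.trans (map_zero f).symm)
    exact hprime.ne_top ((Ideal.eq_top_iff_one _).2 (Ideal.Quotient.eq_zero_iff_mem.1 h3))
  have : p = q.asIdeal := le_antisymm hpq hqp
  subst this
  exact h (mem_extSupport_zero_of_injective hf)

/-- If `Hom(R/q, C)_q = 0`, there is a module `D` which is, locally at `q`, the quotient of `C` by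
a regular element in `q`. -/
theorem exists_regular_quotient [Module.Finite R C] {q : PrimeSpectrum R}
    (h : q ∉ extSupport R 0 (R ⧸ q.asIdeal) C) :
    ∃ D : ModuleCat.{u} R, Module.Finite R D ∧
      (∀ j, q ∈ extSupport R j (R ⧸ q.asIdeal) D →
        q ∈ extSupport R j (R ⧸ q.asIdeal) C ∨ q ∈ extSupport R (j + 1) (R ⧸ q.asIdeal) C) ∧
      (∀ j, q ∈ extSupport R (j + 1) (R ⧸ q.asIdeal) C → q ∈ extSupport R j (R ⧸ q.asIdeal) D) ∧
      ∀ (N : Type u) [AddCommGroup N] [Module R N] [Module.Finite R N] (j : ℕ),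
        (q ∉ extSupport R (j + 1) D N → q ∉ extSupport R j C N) ∧
        (q ∈ extSupport R (j + 1) D N → q ∈ extSupport R j C N ∨ q ∈ extSupport R (j + 1) C N) := by
  have hinj := (primeTorsion q C).injective_subtype
  have hex := LinearMap.exact_subtype_mkQ (primeTorsion q C)
  have hsurj := Submodule.mkQ_surjective (primeTorsion q C)
  -- The torsion vanishes at q, so `C` and its torsion-free quotient have the same Ext at q in both
  -- variables.
  have hT := notMem_support_primeTorsion (C := C) q
  have r1 : ∀ {j : ℕ} {X : Type u} [AddCommGroup X] [Module R X],
      q ∉ extSupport R j X (primeTorsion q C) := fun h => hT (extSupport_subset_right _ h)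
  have r2 : ∀ {j : ℕ} {X : Type u} [AddCommGroup X] [Module R X],
      q ∉ extSupport R j (primeTorsion q C) X := fun h => hT (extSupport_subset_left _ h)
  have c1 : ∀ {j : ℕ} {X : Type u} [AddCommGroup X] [Module R X],
      q ∈ extSupport R j X C ↔ q ∈ extSupport R j X (C ⧸ primeTorsion q C) := fun {j X _ _} =>
    ⟨fun h => (extSupport_cov₂ hinj hex hsurj X j h).resolve_left r1,
      fun h => (extSupport_cov₃ hinj hex hsurj X j h).resolve_right r1⟩
  have c2 : ∀ {j : ℕ} {X : Type u} [AddCommGroup X] [Module R X],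
      q ∈ extSupport R j C X ↔ q ∈ extSupport R j (C ⧸ primeTorsion q C) X := by
    intro j X _ _
    refine ⟨fun h => (extSupport_contra₂ hinj hex hsurj X j h).resolve_right r2, fun h => ?_⟩
    cases j with
    | zero => exact extSupport_zero_subset_of_surjective hsurj X h
    | succ j => exact (extSupport_contra₃ hinj hex hsurj X j h).resolve_left r2
  obtain ⟨x, hxq, hx⟩ := exists_regular_quotient_primeTorsion (fun h' => h (c1.2 h'))
  obtain ⟨g1, g2, g3⟩ := smul_exact_mkQ x hx
  refine ⟨ModuleCat.of R (QuotByElt x (C ⧸ primeTorsion q C)),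
    inferInstanceAs (Module.Finite R (QuotByElt x (C ⧸ primeTorsion q C))), ?_, ?_, ?_⟩
  · intro j hj
    rw [c1, c1]
    exact extSupport_cov₃ g1 g2 g3 _ j hj
  · intro j hj
    rw [c1] at hj
    exact extSupport_succ_subset_of_regular (by rwa [Ideal.annihilator_quotient]) hx j hj
  · intro N _ _ _ j
    rw [c2, c2]
    exact ⟨fun hj => notMem_extSupport_of_succ hxq hx hj,
      fun hj => extSupport_contra₃ g1 g2 g3 N j hj⟩

section Top

variable [Module.Finite R N] {q : PrimeSpectrum R} {m : ℕ}
  (htop : ∀ (C : Type u) [AddCommGroup C] [Module R C] [Module.Finite R C] (j : ℕ), m < j →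
    q ∉ extSupport R j C N)

include htop

/-- Large depth of `C` at `q` forces vanishing of `Ext^j(C, N)_q` for large `j`. -/
theorem notMem_extSupport_of_depth (d : ℕ) : ∀ (C : Type u) [AddCommGroup C] [Module R C]
    [Module.Finite R C], (∀ i < d, q ∉ extSupport R i (R ⧸ q.asIdeal) C) →
      ∀ j, m < j + d → q ∉ extSupport R j C N := by
  induction d with
  | zero => exact fun C _ _ _ _ j hj => htop C j hj
  | succ d ih =>
    intro C _ _ _ h j hj
    obtain ⟨D, _, h1, _, h3⟩ := exists_regular_quotient (h 0 (Nat.succ_pos d))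
    refine (h3 N j).1 (ih D (fun i hi hD => ?_) (j + 1) (by omega))
    exact (h1 i hD).elim (h i (by omega)) (h (i + 1) (by omega))

/-- Here `d` is the depth of C at q. In depth zero R/q embeds in C, and Ext^m(C, N) maps onto
Ext^m(R/q, N) at q because Ext^(m+1) vanishes there; hence m ≤ e. Otherwise, dividing by a regular
element lowers the depth by one and raises the Ext bound `e` by one. -/
theorem top_le_add_depth (hm : q ∈ extSupport R m (R ⧸ q.asIdeal) N) (d : ℕ) :
    ∀ (e : ℕ) (C : Type u) [AddCommGroup C] [Module R C] [Module.Finite R C],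
      (∀ i < d, q ∉ extSupport R i (R ⧸ q.asIdeal) C) → q ∈ extSupport R d (R ⧸ q.asIdeal) C →
      (∀ j, e < j → q ∉ extSupport R j C N) → m ≤ e + d := by
  induction d with
  | zero =>
    intro e C _ _ _ _ h0 he
    obtain ⟨f, hf⟩ := exists_injective_of_mem_extSupport_zero h0
    by_contra hlt
    exact (extSupport_contra₁ hf (LinearMap.exact_map_mkQ_range f) (Submodule.mkQ_surjective _) N m
      hm).elim (he m (by omega)) (htop _ (m + 1) (Nat.lt_succ_self m))
  | succ d ih =>
    intro e C _ _ _ h hd he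
    obtain ⟨D, _, h1, h2, h3⟩ := exists_regular_quotient (h 0 (Nat.succ_pos d))
    have := ih (e + 1) D (fun i hi hD => (h1 i hD).elim (h i (by omega)) (h (i + 1) (by omega)))
      (h2 d hd) (fun j hj hD => by
        obtain ⟨j, rfl⟩ : ∃ j', j = j' + 1 := ⟨j - 1, by omega⟩
        exact ((h3 N j).2 hD).elim (he j (by omega)) (he (j + 1) (by omega)))
    omega

end Top

end LocalExt

/-! ### Heights in the spectrum and in the support of a module. -/

section Height

variable {R : Type u} [CommRing R] [IsNoetherianRing R]

theorem height_primeSpectrum_ne_top (q : PrimeSpectrum R) : Order.height q ≠ ⊤ := by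
  rw [← PrimeSpectrum.height_eq_orderHeight]
  exact Ideal.height_ne_top q.2.ne_top

/-- The height of a prime, as a natural number. -/
noncomputable def primeHt (q : PrimeSpectrum R) : ℕ := (Order.height q).toNat

theorem coe_primeHt (q : PrimeSpectrum R) : (primeHt q : ℕ∞) = Order.height q :=
  ENat.natCast_toNat (height_primeSpectrum_ne_top q)

theorem height_subtype_le (S : Set (PrimeSpectrum R)) (q : S) :
    Order.height q ≤ primeHt q.1 := by
  rw [coe_primeHt]
  exact Order.height_le_height_apply_of_strictMono (fun p : S => p.1) (fun _ _ h => h) q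

theorem exists_height_subtype_eq (S : Set (PrimeSpectrum R)) (q : S) :
    ∃ n : ℕ, Order.height q = n :=
  ⟨(Order.height q).toNat, (ENat.natCast_toNat
    (ne_top_of_le_ne_top (ENat.natCast_ne_top _) (height_subtype_le S q))).symm⟩

/-- Going up along saturated chains in a set of primes that is stable under specialization. -/
theorem mem_extSupport_of_height {N : Type u} [AddCommGroup N] [Module R N] [Module.Finite R N]
    {S : Set (PrimeSpectrum R)} (hS : IsUpperSet S)
    (h0 : ∀ q : S, IsMin q → q.1 ∈ extSupport R 0 (R ⧸ q.1.asIdeal) N) (h : ℕ) :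
    ∀ q : S, Order.height q = h → q.1 ∈ extSupport R h (R ⧸ q.1.asIdeal) N := by
  induction h with
  | zero => exact fun q hq => h0 q (Order.height_eq_zero.1 (by simpa using hq))
  | succ h ih =>
    intro q hq
    obtain ⟨_, ⟨p, hpq, hp⟩, hle⟩ := Order.height_eq_coe_add_one_iff.1
      (by simpa using hq : Order.height q = (h : ℕ∞) + 1)
    -- A prime strictly between p and q would lie in S, as S is closed under specialization, and
    -- would push the height of q beyond h + 1. Hence p ⋖ q in the whole spectrum.
    refine mem_extSupport_of_covBy (p := p.1) ⟨hpq, fun z hpz hzq => ?_⟩ (ih p hp)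
    have hz : z ∈ S := hS hpz.le p.2
    have h1 := hle ⟨z, hz⟩ hzq
    have h2 : Order.height p + 1 ≤ Order.height (⟨z, hz⟩ : S) := Order.height_add_one_le hpz
    rw [hp] at h2
    have h3 : ((h + 1 : ℕ) : ℕ∞) ≤ (h : ℕ) := by
      push_cast
      exact h2.trans h1
    exact absurd (ENat.natCast_le_natCast.1 h3) (by omega)

omit [IsNoetherianRing R] in
theorem isUpperSet_support (N : Type u) [AddCommGroup N] [Module R N] :
    IsUpperSet (Module.support R N) := fun _ _ h hp => Module.mem_support_mono h hp

theorem mem_extSupport_zero_of_isMin {N : Type u} [AddCommGroup N] [Module R N]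
    [Module.Finite R N] (q : Module.support R N) (hq : IsMin q) :
    q.1 ∈ extSupport R 0 (R ⧸ q.1.asIdeal) N := by
  have hmin : q.1.asIdeal ∈ (Module.annihilator R N).minimalPrimes := by
    refine ⟨⟨q.1.2, Module.annihilator_le_of_mem_support q.2⟩, fun p hp hpq => ?_⟩
    have hpS : (⟨p, hp.1⟩ : PrimeSpectrum R) ∈ Module.support R N :=
      Module.mem_support_iff_of_finite.2 hp.2
    exact hq (show (⟨_, hpS⟩ : Module.support R N) ≤ q from hpq)
  have hass := Module.associatedPrimes.minimalPrimes_annihilator_subset_associatedPrimes R N hmin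
  obtain ⟨_, f, hf⟩ := (isAssociatedPrime_iff_exists_injective_linearMap _ _).1 hass
  exact mem_extSupport_zero_of_injective hf

/-- This is the form in which "depth is at most dimension" is used for the localization of N at q.
-/
theorem mem_extSupport_moduleHeight {N : Type u} [AddCommGroup N] [Module R N]
    [Module.Finite R N] (q : Module.support R N) {h : ℕ} (hq : moduleHeight R N q = h) :
    q.1 ∈ extSupport R h (R ⧸ q.1.asIdeal) N :=
  mem_extSupport_of_height (isUpperSet_support N) mem_extSupport_zero_of_isMin h q hq

omit [IsNoetherianRing R] in
variable (R) in
theorem support_self [Nontrivial R] : Module.support R R = Set.univ :=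
  Set.eq_univ_of_forall fun q => by
    rw [Module.mem_support_iff_of_finite, Module.annihilator_eq_bot.2 inferInstance]
    exact bot_le

theorem moduleHeight_self (q : Module.support R R) : moduleHeight R R q = primeHt q.1 := by
  rw [coe_primeHt]
  have : Nontrivial R := ⟨⟨0, 1, fun h => q.1.2.ne_top (by
    rw [Ideal.eq_top_iff_one, ← h]; exact zero_mem _)⟩⟩
  exact Order.height_orderIso ((OrderIso.setCongr _ _ (support_self R)).trans OrderIso.Set.univ) q ▸ rfl

end Height

/-! ### Depth and height over a Gorenstein local ring. -/

section GorensteinHeight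

variable {R : Type u} [CommRing R] [IsGorensteinLocalRing R]

open CategoryTheory CategoryTheory.Abelian in
variable (R) in
theorem IsGorensteinLocalRing.exists_extSupport_eq_empty :
    ∃ n : ℕ, ∀ (C : Type u) [AddCommGroup C] [Module R C] (j : ℕ), n < j →
      extSupport R j C R = ∅ := by
  obtain ⟨n, hn⟩ := IsGorensteinLocalRing.finite_injectiveDimension (R := R)
  exact ⟨n, fun C _ _ j hj => extSupport_eq_empty.2 fun e =>
    e.eq_zero_of_hasInjectiveDimensionLT (n + 1) hj⟩

/-- The index `m` is the top nonvanishing degree at q. Applying `top_le_add_depth` to C = R, which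
has no higher Ext, shows that the lowest nonvanishing degree of Ext(R/q, R) at q is also at least
`m`. -/
theorem exists_extSupport_iff (q : PrimeSpectrum R) : ∃ m : ℕ,
    (∀ j, q ∈ extSupport R j (R ⧸ q.asIdeal) R ↔ j = m) ∧
    ∀ (C : Type u) [AddCommGroup C] [Module R C] [Module.Finite R C] (j : ℕ), m < j →
      q ∉ extSupport R j C R := by
  classical
  obtain ⟨n, hn⟩ := IsGorensteinLocalRing.exists_extSupport_eq_empty R
  obtain ⟨m, hm, htop⟩ := exists_top_extSupport (N := R) (fun C _ _ _ j hj => hn C j hj) (q := q)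
    (support_self R ▸ Set.mem_univ q)
  have hex : ∃ j, q ∈ extSupport R j (R ⧸ q.asIdeal) R := ⟨m, hm⟩
  have hle : m ≤ Nat.find hex := by
    have := top_le_add_depth htop hm (Nat.find hex) 0 R (fun i hi => Nat.find_min hex hi)
      (Nat.find_spec hex) (fun j hj => by
        obtain ⟨j, rfl⟩ : ∃ j', j = j' + 1 := ⟨j - 1, by omega⟩
        rw [extSupport_of_projective]
        exact Set.notMem_empty _)
    omega
  refine ⟨m, fun j => ⟨fun hj => ?_, fun h => h ▸ hm⟩, htop⟩
  have h1 := Nat.find_min' hex hj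
  by_contra hne
  exact htop _ j (by omega) hj

/-- Over a Gorenstein ring, `Ext^j(R/q, R)_q` is nonzero precisely for `j = ht q`. -/
theorem mem_extSupport_self_iff (q : PrimeSpectrum R) (j : ℕ) :
    q ∈ extSupport R j (R ⧸ q.asIdeal) R ↔ j = primeHt q := by
  obtain ⟨m, hm, _⟩ := exists_extSupport_iff q
  have := mem_extSupport_moduleHeight (N := R) ⟨q, support_self R ▸ Set.mem_univ q⟩
    (moduleHeight_self _)
  rw [hm] at this
  rw [hm, this]

theorem notMem_extSupport_of_primeHt_lt {q : PrimeSpectrum R} {C : Type u} [AddCommGroup C]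
    [Module R C] [Module.Finite R C] {j : ℕ} (hj : primeHt q < j) : q ∉ extSupport R j C R := by
  obtain ⟨m, hm, htop⟩ := exists_extSupport_iff q
  have : primeHt q = m := (hm _).1 ((mem_extSupport_self_iff q _).2 rfl)
  exact htop C j (this ▸ hj)

/-- Modules without higher `Ext` into a Gorenstein ring are locally of maximal depth. -/
theorem notMem_extSupport_of_lt_primeHt {q : PrimeSpectrum R} {C : Type u} [AddCommGroup C]
    [Module R C] [Module.Finite R C] (hC : ∀ j, extSupport R (j + 1) C R = ∅) {j : ℕ}
    (hj : j < primeHt q) : q ∉ extSupport R j (R ⧸ q.asIdeal) C := by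
  classical
  intro hjq
  have hex : ∃ j, q ∈ extSupport R j (R ⧸ q.asIdeal) C := ⟨j, hjq⟩
  have := top_le_add_depth (fun C _ _ _ j hj => notMem_extSupport_of_primeHt_lt hj)
    ((mem_extSupport_self_iff q _).2 rfl) (Nat.find hex) 0 C (fun i hi => Nat.find_min hex hi)
      (Nat.find_spec hex) (fun j hj => by
        obtain ⟨j, rfl⟩ : ∃ j', j = j' + 1 := ⟨j - 1, by omega⟩
        rw [hC]
        exact Set.notMem_empty _)
  have h1 := Nat.find_min' hex hjq
  omega

/-- The C-height h is at most ht q, and Ext^h(R/q, C) is nonzero at q. Since C has depth at least ht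
q there, h cannot be smaller. -/
theorem moduleHeight_eq_primeHt {C : Type u} [AddCommGroup C]
    [Module R C] [Module.Finite R C] (hC : ∀ j, extSupport R (j + 1) C R = ∅)
    (q : Module.support R C) : moduleHeight R C q = primeHt q.1 := by
  obtain ⟨h, hh⟩ := exists_height_subtype_eq _ q
  have h1 := mem_extSupport_moduleHeight q hh
  have h2 := height_subtype_le _ q
  rw [moduleHeight]
  rw [hh] at h2 ⊢
  have h3 : h ≤ primeHt q.1 := ENat.natCast_le_natCast.1 h2
  have h4 : ¬ h < primeHt q.1 := fun h' => notMem_extSupport_of_lt_primeHt hC h' h1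
  exact congrArg _ (by omega)

/-- All saturated chains from a minimal prime to `q` have the same length. -/
theorem primeHt_le_moduleHeight {C : Type u} [AddCommGroup C] [Module R C]
    {p : PrimeSpectrum R} (hp : p ∈ Module.support R C) (hp0 : primeHt p = 0)
    (q : Module.support R C) (hpq : p ≤ q.1) : (primeHt q.1 : ℕ∞) ≤ moduleHeight R C q := by
  have hS : IsUpperSet (Set.Ici p) := isUpperSet_Ici p
  obtain ⟨h, hh⟩ := exists_height_subtype_eq (Set.Ici p) ⟨q.1, hpq⟩
  -- Climbing from p inside `Set.Ici p` produces a nonzero Ext^h(R/q, R) at q, with h the height of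
  -- q above p. Only the degree ht q is possible, so h = ht q.
  have h1 := mem_extSupport_of_height (N := R) hS (fun z hz => by
    have : z.1 = p := le_antisymm (hz (show (⟨p, Set.mem_Ici.2 le_rfl⟩ : Set.Ici p) ≤ z from z.2)) z.2
    rw [this, mem_extSupport_self_iff, hp0]) h ⟨q.1, hpq⟩ hh
  rw [mem_extSupport_self_iff] at h1
  rw [← h1, ← hh]
  exact Order.height_le_height_apply_of_strictMono
    (fun z : Set.Ici p => (⟨z.1, Module.mem_support_mono z.2 hp⟩ : Module.support R C))
    (fun _ _ h => h) ⟨q.1, hpq⟩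

end GorensteinHeight

/-! ### Ext-acyclic modules, complete resolutions, and Gorenstein projectivity. -/

section TotallyReflexive

variable {R : Type u} [CommRing R]

open CategoryTheory CategoryTheory.Abelian in
theorem extSupport_subset_of_retract {C N N' : Type u} [AddCommGroup C] [Module R C]
    [AddCommGroup N] [Module R N] [AddCommGroup N'] [Module R N'] (i : N →ₗ[R] N')
    (r : N' →ₗ[R] N) (h : r ∘ₗ i = LinearMap.id) (j : ℕ) :
    extSupport R j C N ⊆ extSupport R j C N' := by
  refine Module.support_subset_of_injective
    ((Ext.mk₀ (ModuleCat.ofHom i)).postcompOfLinear R (ModuleCat.of R C) (add_zero j)) ?_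
  have hid : ModuleCat.ofHom i ≫ ModuleCat.ofHom r = 𝟙 (ModuleCat.of R N) := by
    rw [← ModuleCat.ofHom_comp, h]
    rfl
  refine Function.LeftInverse.injective
    (g := fun e => e.comp (Ext.mk₀ (ModuleCat.ofHom r)) (add_zero j)) fun e => ?_
  change (e.comp (Ext.mk₀ (ModuleCat.ofHom i)) (add_zero j)).comp
    (Ext.mk₀ (ModuleCat.ofHom r)) (add_zero j) = e
  rw [Ext.comp_assoc_of_second_deg_zero, Ext.mk₀_comp_mk₀, hid, Ext.comp_mk₀_id]

variable (R) in
/-- A finitely generated module `M` with `Ext^j(M, R) = 0` for all `j > 0`. -/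
structure ExtAcyclic (M : Type u) [AddCommGroup M] [Module R M] : Prop where
  finite : Module.Finite R M
  ext : ∀ j, extSupport R (j + 1) M R = ∅

/-- A projective module is a retract of a direct sum of copies of R, and vanishing of Ext out of a
finitely generated module passes to direct sums. -/
theorem ExtAcyclic.extSupport_projective [IsNoetherianRing R] {M : Type u} [AddCommGroup M]
    [Module R M] (hM : ExtAcyclic R M) (Q : Type u) [AddCommGroup Q] [Module R Q]
    [Module.Projective R Q] (j : ℕ) : extSupport R (j + 1) M Q = ∅ := by
  classical
  have := hM.finite
  obtain ⟨s, hs⟩ := Module.projective_def'.1 (inferInstance : Module.Projective R Q)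
  refine Set.subset_eq_empty (extSupport_subset_of_retract s _ hs (j + 1)) ?_
  rw [extSupport_congr_right (finsuppLEquivDirectSum R R Q)]
  exact extSupport_directSum (j + 1) M fun _ => hM.ext j

theorem ExtAcyclic.exists_syzygy [IsNoetherianRing R] {M : Type u} [AddCommGroup M] [Module R M]
    (hM : ExtAcyclic R M) : ∃ (K : ModuleCat.{u} R) (k : ℕ) (i : K →ₗ[R] (Fin k → R))
      (p : (Fin k → R) →ₗ[R] M), Function.Injective i ∧ Function.Exact i p ∧
        Function.Surjective p ∧ ExtAcyclic R K := by
  have := hM.finite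
  obtain ⟨k, p, hp⟩ := exists_surjective_fin R M
  refine ⟨ModuleCat.of R (LinearMap.ker p), k, (LinearMap.ker p).subtype, p,
    (LinearMap.ker p).injective_subtype, LinearMap.exact_subtype_ker_map p, hp,
    inferInstanceAs (Module.Finite R (LinearMap.ker p)), fun j => ?_⟩
  change extSupport R (j + 1) (LinearMap.ker p) R = ∅
  rw [← extSupport_succ_succ hp, hM.ext (j + 1)]

/-- Let K be the common kernel of all functionals and q an associated prime of K. As R/q embeds in
M, the depth bound forces ht q = 0, so R/q also embeds in R. Ext¹ of the cokernel of R/q → M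
vanishes at q, hence a multiple of that embedding by some s ∉ q extends to M. The extension is
nonzero on K, a contradiction. -/
theorem ExtAcyclic.exists_ne_zero [IsGorensteinLocalRing R] {M : Type u} [AddCommGroup M]
    [Module R M] (hM : ExtAcyclic R M) {z : M} (hz : z ≠ 0) : ∃ f : M →ₗ[R] R, f z ≠ 0 := by
  by_contra! hn
  have := hM.finite
  let K : Submodule R M := ⨅ f : M →ₗ[R] R, LinearMap.ker f
  have : Nontrivial K := ⟨⟨⟨z, (Submodule.mem_iInf _).2 hn⟩, 0, fun h => hz (congrArg Subtype.val h)⟩⟩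
  obtain ⟨q', hq'⟩ := associatedPrimes.nonempty R K
  obtain ⟨hprime, f, hf⟩ := (isAssociatedPrime_iff_exists_injective_linearMap _ _).1 hq'
  let q : PrimeSpectrum R := ⟨q', hprime⟩
  let g : (R ⧸ q.asIdeal) →ₗ[R] M := K.subtype ∘ₗ f
  have hg : Function.Injective g := K.injective_subtype.comp hf
  have hq0 : primeHt q = 0 := by
    by_contra h0
    exact notMem_extSupport_of_lt_primeHt hM.ext (Nat.pos_of_ne_zero h0)
      (mem_extSupport_zero_of_injective hg)
  obtain ⟨h, hh⟩ := exists_injective_of_mem_extSupport_zero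
    ((mem_extSupport_self_iff q 0).2 hq0.symm)
  obtain ⟨s, hs, ψ, hψ⟩ := exists_smul_extension hg (LinearMap.exact_map_mkQ_range g)
    (Submodule.mkQ_surjective _) (notMem_extSupport_of_primeHt_lt (q := q) (by omega)) h
  have h1 : ψ (g (Ideal.Quotient.mk q.asIdeal 1)) = s • h (Ideal.Quotient.mk q.asIdeal 1) :=
    LinearMap.congr_fun hψ _
  have h2 : ψ (g (Ideal.Quotient.mk q.asIdeal 1)) = 0 :=
    (Submodule.mem_iInf _).1 (f (Ideal.Quotient.mk q.asIdeal 1)).2 ψ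
  rw [h2, ← map_smul] at h1
  have h3 := hh (h1.symm.trans (map_zero h).symm)
  rw [← Ideal.Quotient.mk_eq_mk, ← Submodule.Quotient.mk_smul, Submodule.Quotient.mk_eq_zero,
    smul_eq_mul, mul_one] at h3
  exact hs h3

/-- The coordinates of `i` generate the dual of M, so every functional on M factors through `i`.
This gives injectivity, since functionals separate points, and also Ext¹(C, R) = 0; higher Ext
follows by shifting. -/
theorem ExtAcyclic.exists_cosyzygy [IsGorensteinLocalRing R] {M : Type u} [AddCommGroup M]
    [Module R M] (hM : ExtAcyclic R M) : ∃ (C : ModuleCat.{u} R) (k : ℕ)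
      (i : M →ₗ[R] (Fin k → R)) (p : (Fin k → R) →ₗ[R] C), Function.Injective i ∧
        Function.Exact i p ∧ Function.Surjective p ∧ ExtAcyclic R C := by
  have := hM.finite
  have : Module.Finite R (M →ₗ[R] R) := inferInstance
  obtain ⟨k, v, hv⟩ := exists_surjective_fin R (M →ₗ[R] R)
  let i : M →ₗ[R] (Fin k → R) := LinearMap.pi fun j => v (Pi.single j 1)
  have hext : ∀ φ : M →ₗ[R] R, ∃ ψ : (Fin k → R) →ₗ[R] R, ψ ∘ₗ i = φ := by
    intro φ
    obtain ⟨c, rfl⟩ := hv φ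
    refine ⟨∑ j, c j • LinearMap.proj j, LinearMap.ext fun z => ?_⟩
    conv_rhs => rw [pi_eq_sum_univ' c]
    simp [i, LinearMap.sum_apply]
  have hi : Function.Injective i := by
    rw [injective_iff_map_eq_zero]
    intro z hz
    by_contra h0
    obtain ⟨f, hf⟩ := hM.exists_ne_zero h0
    obtain ⟨ψ, rfl⟩ := hext f
    exact hf (by rw [LinearMap.comp_apply, hz, map_zero])
  have hex := LinearMap.exact_map_mkQ_range i
  have hs := Submodule.mkQ_surjective (LinearMap.range i)
  refine ⟨ModuleCat.of R ((Fin k → R) ⧸ LinearMap.range i), k, i, (LinearMap.range i).mkQ, hi,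
    hex, hs, inferInstanceAs (Module.Finite R ((Fin k → R) ⧸ LinearMap.range i)), fun j => ?_⟩
  cases j with
  | zero => exact extSupport_one_of_extension hi hex hs (extSupport_of_projective 0) hext
  | succ j =>
    refine Set.subset_eq_empty (extSupport_contra₃ hi hex hs R (j + 1)) ?_
    rw [hM.ext j, extSupport_of_projective (C := Fin k → R), Set.union_empty]

variable (R) in
/-- A sequence of short exact sequences `0 → Z n → R^(k n) → Z (n + 1) → 0` of modules in the class
`ExtAcyclic`. -/
structure FreeCompleteResolution where
  Z : ℤ → ModuleCat.{u} R
  k : ℤ → ℕ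
  i : ∀ n, Z n →ₗ[R] (Fin (k n) → R)
  p : ∀ n, (Fin (k n) → R) →ₗ[R] Z (n + 1)
  injective : ∀ n, Function.Injective (i n)
  exact : ∀ n, Function.Exact (i n) (p n)
  surjective : ∀ n, Function.Surjective (p n)
  extAcyclic : ∀ n, ExtAcyclic R (Z n)

variable (R) in
/-- The class of all `ExtAcyclic` modules. -/
abbrev ExtAcyclicModule := {M : ModuleCat.{u} R // ExtAcyclic R M}

/-- `N'` is the cokernel of an embedding of `N` into a finite free module. -/
def IsCosyzygy (N N' : ModuleCat.{u} R) : Prop :=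
  ∃ (k : ℕ) (i : N →ₗ[R] (Fin k → R)) (p : (Fin k → R) →ₗ[R] N'),
    Function.Injective i ∧ Function.Exact i p ∧ Function.Surjective p

theorem ExtAcyclicModule.exists_next [IsGorensteinLocalRing R] (N : ExtAcyclicModule R) :
    ∃ N' : ExtAcyclicModule R, IsCosyzygy N.1 N'.1 := by
  obtain ⟨C, k, i, p, h1, h2, h3, h4⟩ := N.2.exists_cosyzygy
  exact ⟨⟨C, h4⟩, k, i, p, h1, h2, h3⟩

theorem ExtAcyclicModule.exists_prev [IsGorensteinLocalRing R] (N : ExtAcyclicModule R) :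
    ∃ N' : ExtAcyclicModule R, IsCosyzygy N'.1 N.1 := by
  obtain ⟨C, k, i, p, h1, h2, h3, h4⟩ := N.2.exists_syzygy
  exact ⟨⟨C, h4⟩, k, i, p, h1, h2, h3⟩

/-- The syzygies of an `ExtAcyclic` module in both directions. -/
noncomputable def ExtAcyclicModule.shift [IsGorensteinLocalRing R] (M : ExtAcyclicModule R) :
    ℤ → ExtAcyclicModule R
  | Int.ofNat n => (fun N : ExtAcyclicModule R => N.exists_next.choose)^[n] M
  | Int.negSucc n => (fun N : ExtAcyclicModule R => N.exists_prev.choose)^[n + 1] M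

theorem ExtAcyclicModule.isCosyzygy_shift [IsGorensteinLocalRing R] (M : ExtAcyclicModule R)
    (n : ℤ) : IsCosyzygy (M.shift n).1 (M.shift (n + 1)).1 := by
  have h1 : ∀ N N' : ExtAcyclicModule R, N' = N.exists_next.choose → IsCosyzygy N.1 N'.1 := by
    rintro N _ rfl
    exact N.exists_next.choose_spec
  have h2 : ∀ N N' : ExtAcyclicModule R, N' = N.exists_prev.choose → IsCosyzygy N'.1 N.1 := by
    rintro N _ rfl
    exact N.exists_prev.choose_spec
  match n with
  | Int.ofNat n => exact h1 _ _ (Function.iterate_succ_apply' _ n M)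
  | Int.negSucc 0 => exact h2 _ _ rfl
  | Int.negSucc (n + 1) => exact h2 _ _ (Function.iterate_succ_apply' _ (n + 1) M)

theorem ExtAcyclic.exists_freeCompleteResolution [IsGorensteinLocalRing R] {M : Type u}
    [AddCommGroup M] [Module R M] (hM : ExtAcyclic R M) :
    ∃ F : FreeCompleteResolution R, F.Z 0 = ModuleCat.of R M := by
  let N : ExtAcyclicModule R := ⟨ModuleCat.of R M, hM⟩
  choose k i p h1 h2 h3 using N.isCosyzygy_shift
  exact ⟨⟨fun n => (N.shift n).1, k, i, p, h1, h2, h3, fun n => (N.shift n).2⟩, rfl⟩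

namespace FreeCompleteResolution

variable (F : FreeCompleteResolution R)

/-- The differential of a complete resolution. -/
def d (n : ℤ) : (Fin (F.k n) → R) →ₗ[R] (Fin (F.k (n + 1)) → R) := F.i (n + 1) ∘ₗ F.p n

theorem d_exact (n : ℤ) : Function.Exact (F.d n) (F.d (n + 1)) := by
  intro x
  constructor
  · intro hx
    have : F.p (n + 1) x = 0 := F.injective (n + 1 + 1) (hx.trans (map_zero _).symm)
    obtain ⟨z, rfl⟩ := (F.exact (n + 1) x).1 this
    obtain ⟨y, rfl⟩ := F.surjective n z
    exact ⟨y, rfl⟩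
  · rintro ⟨y, rfl⟩
    change F.i _ (F.p _ (F.i _ (F.p n y))) = 0
    rw [(F.exact (n + 1)).apply_apply_eq_zero, map_zero]

theorem ker_d (n : ℤ) : LinearMap.ker (F.d n) = LinearMap.range (F.i n) := by
  ext x
  rw [LinearMap.mem_ker, d, LinearMap.comp_apply, LinearMap.mem_range, ← Set.mem_range,
    ← F.exact n x]
  exact ⟨fun h => F.injective (n + 1) (h.trans (map_zero _).symm), fun h => by rw [h, map_zero]⟩

/-- A map killed by the incoming differential factors through the next Z, which is embedded in the
next free module. The vanishing of Ext¹ extends it there. -/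
theorem hom_exact (n : ℤ) (Q : Type u) [AddCommGroup Q] [Module R Q]
    (hQ : extSupport R 1 (F.Z (n + 1 + 1 + 1)) Q = ∅) :
    Function.Exact (fun f : (Fin (F.k (n + 1 + 1)) → R) →ₗ[R] Q => f ∘ₗ F.d (n + 1))
      (fun f : (Fin (F.k (n + 1)) → R) →ₗ[R] Q => f ∘ₗ F.d n) := by
  intro f
  constructor
  · intro hf
    have h1 : LinearMap.ker (F.p (n + 1)) ≤ LinearMap.ker f := by
      intro x hx
      obtain ⟨z, rfl⟩ := (F.exact (n + 1) x).1 hx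
      obtain ⟨y, rfl⟩ := F.surjective n z
      exact LinearMap.congr_fun hf y
    obtain ⟨f', hf'⟩ : ∃ f' : F.Z (n + 1 + 1) →ₗ[R] Q, f' ∘ₗ F.p (n + 1) = f := by
      refine ⟨(LinearMap.ker (F.p (n + 1))).liftQ f h1 ∘ₗ
        ((F.p (n + 1)).quotKerEquivOfSurjective (F.surjective _)).symm.toLinearMap,
        LinearMap.ext fun x => ?_⟩
      rw [LinearMap.comp_apply, LinearMap.comp_apply, LinearEquiv.coe_coe]
      have : ((F.p (n + 1)).quotKerEquivOfSurjective (F.surjective _)).symm (F.p (n + 1) x) =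
          Submodule.Quotient.mk x := by
        rw [LinearEquiv.symm_apply_eq]
        rfl
      rw [this]
      rfl
    obtain ⟨g, hg⟩ := exists_extension (F.injective (n + 1 + 1)) (F.exact _) (F.surjective _) hQ f'
    refine ⟨g, ?_⟩
    change g ∘ₗ (F.i _ ∘ₗ F.p _) = f
    rw [← LinearMap.comp_assoc, hg, hf']
  · rintro ⟨g, rfl⟩
    refine LinearMap.ext fun x => ?_
    change g (F.d (n + 1) (F.d n x)) = 0
    rw [(F.d_exact n).apply_apply_eq_zero, map_zero]

end FreeCompleteResolution

theorem ExtAcyclic.isGorensteinProjective [IsGorensteinLocalRing R] {M : Type u}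
    [AddCommGroup M] [Module R M] (hM : ExtAcyclic R M) : IsGorensteinProjective R M := by
  obtain ⟨F, hF⟩ := hM.exists_freeCompleteResolution
  refine ⟨fun n => ModuleCat.of R (Fin (F.k n) → R), F.d,
    fun n => inferInstanceAs (Module.Projective R (Fin (F.k n) → R)), F.d_exact, fun Q hQ n => ?_,
    ?_⟩
  · exact F.hom_exact n Q ((F.extAcyclic _).extSupport_projective Q 0)
  · have e1 : M ≃ₗ[R] F.Z 0 := (CategoryTheory.eqToIso hF.symm).toLinearEquiv
    exact ⟨e1.trans ((LinearEquiv.ofInjective _ (F.injective 0)).trans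
      (LinearEquiv.ofEq _ _ (F.ker_d 0).symm))⟩

theorem IsGorensteinProjective.extSupport_eq_empty {M : Type u} [AddCommGroup M] [Module R M]
    (hM : IsGorensteinProjective R M) (Q : Type u) [AddCommGroup Q] [Module R Q]
    [hQ : Module.Projective R Q] (j : ℕ) : extSupport R (j + 1) M Q = ∅ := by
  obtain ⟨P, d, hP, hd, hhom, ⟨e⟩⟩ := hM
  let K : ∀ n, Submodule R (P n) := fun n => LinearMap.ker (d n)
  let δ : ∀ n, P n →ₗ[R] K (n + 1) := fun n =>
    (d n).codRestrict (K (n + 1)) fun x => (hd n).apply_apply_eq_zero x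
  have hδ : ∀ n, Function.Surjective (δ n) := fun n x => by
    obtain ⟨y, hy⟩ := (hd n x.1).1 x.2
    exact ⟨y, Subtype.ext hy⟩
  have hex : ∀ n, Function.Exact (K n).subtype (δ n) := fun n x => by
    constructor
    · intro hx
      exact ⟨⟨x, congrArg Subtype.val hx⟩, rfl⟩
    · rintro ⟨x, rfl⟩
      exact Subtype.ext x.2
  have h1 : ∀ n, extSupport R 1 (K n) Q = ∅ := by
    intro n
    -- Extending a map K (m+2) → Q to P (m+2) amounts to exactness of Hom(-, Q) at P (m+1). This
    -- yields Ext¹ of the cokernel K (m+3).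
    obtain ⟨m, rfl⟩ : ∃ m, n = m + 1 + 1 + 1 := ⟨n - 3, by ring⟩
    have := hP (m + 1 + 1)
    refine extSupport_one_of_extension (K (m + 1 + 1)).injective_subtype (hex _) (hδ _)
      (extSupport_of_projective 0) fun φ => ?_
    obtain ⟨g, hg⟩ := (hhom (ModuleCat.of R Q) hQ m (φ ∘ₗ δ (m + 1))).1 (by
      ext x
      change φ (δ (m + 1) (d m x)) = 0
      have : δ (m + 1) (d m x) = 0 := Subtype.ext ((hd m).apply_apply_eq_zero x)
      rw [this, map_zero])
    refine ⟨g, LinearMap.ext fun x => ?_⟩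
    obtain ⟨y, rfl⟩ := hδ (m + 1) x
    exact LinearMap.congr_fun hg y
  have h2 : ∀ j n, extSupport R (j + 1) (K n) Q = ∅ := by
    intro j
    induction j with
    | zero => exact h1
    | succ j ih =>
      intro n
      obtain ⟨m, rfl⟩ : ∃ m, n = m + 1 := ⟨n - 1, by ring⟩
      have := hP m
      refine Set.subset_eq_empty (extSupport_contra₃ (K m).injective_subtype (hex _) (hδ _) Q
        (j + 1)) ?_
      rw [ih m, extSupport_of_projective (C := P m), Set.union_empty]
  rw [extSupport_congr_left e]
  exact h2 j 0

/-- Exactness under Hom(I, -) lifts maps from I into a kernel through the preceding injective term,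
which gives Ext¹; higher degrees shift along the complex. -/
theorem IsGorensteinInjective.extSupport_eq_empty {Y : Type u} [AddCommGroup Y] [Module R Y]
    (hY : IsGorensteinInjective R Y) (I : Type u) [AddCommGroup I] [Module R I]
    [hI : Module.Injective R I] (j : ℕ) : extSupport R (j + 1) I Y = ∅ := by
  obtain ⟨E, d, hE, hd, hhom, ⟨e⟩⟩ := hY
  let K : ∀ n, Submodule R (E n) := fun n => LinearMap.ker (d n)
  let δ : ∀ n, E n →ₗ[R] K (n + 1) := fun n =>
    (d n).codRestrict (K (n + 1)) fun x => (hd n).apply_apply_eq_zero x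
  have hδ : ∀ n, Function.Surjective (δ n) := fun n x => by
    obtain ⟨y, hy⟩ := (hd n x.1).1 x.2
    exact ⟨y, Subtype.ext hy⟩
  have hex : ∀ n, Function.Exact (K n).subtype (δ n) := fun n x => by
    constructor
    · intro hx
      exact ⟨⟨x, congrArg Subtype.val hx⟩, rfl⟩
    · rintro ⟨x, rfl⟩
      exact Subtype.ext x.2
  have h2 : ∀ j n, extSupport R (j + 1) I (K n) = ∅ := by
    intro j
    induction j with
    | zero =>
      intro n
      have := hE n
      refine extSupport_one_of_lift (K n).injective_subtype (hex _) (hδ _)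
        (extSupport_of_injective 0) fun φ => ?_
      obtain ⟨g, hg⟩ := (hhom (ModuleCat.of R I) hI n ((K (n + 1)).subtype ∘ₗ φ)).1 (by
        ext x
        exact (φ x).2)
      exact ⟨g, LinearMap.ext fun x => Subtype.ext (LinearMap.congr_fun hg x)⟩
    | succ j ih =>
      intro n
      have := hE n
      refine Set.subset_eq_empty (extSupport_cov₁ (K n).injective_subtype (hex _) (hδ _) I
        (j + 1)) ?_
      rw [ih (n + 1), extSupport_of_injective (N := E n), Set.union_empty]
  rw [extSupport_congr_right e]
  exact h2 j 0

end TotallyReflexive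

/-! ### Matrices acting on powers of an injective module, and Gorenstein injectivity of J ⊗ M. -/

section MatrixAction

open scoped TensorProduct

variable {R : Type u} [CommRing R]

/-- The action of a matrix over `R` on vectors with entries in a module `W`. -/
noncomputable def Matrix.actOn {l k : ℕ} (A : Matrix (Fin l) (Fin k) R) (W : Type u)
    [AddCommGroup W] [Module R W] : (Fin k → W) →ₗ[R] (Fin l → W) :=
  LinearMap.pi fun a => ∑ b, A a b • LinearMap.proj b

theorem Matrix.actOn_apply {l k : ℕ} (A : Matrix (Fin l) (Fin k) R) (W : Type u)
    [AddCommGroup W] [Module R W] (x : Fin k → W) (a : Fin l) :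
    A.actOn W x a = ∑ b, A a b • x b := by
  simp [Matrix.actOn, LinearMap.sum_apply]

theorem Matrix.actOn_toMatrix' {l k : ℕ} (d : (Fin k → R) →ₗ[R] (Fin l → R)) :
    (LinearMap.toMatrix' d).actOn R = d := by
  refine LinearMap.ext fun x => funext fun a => ?_
  rw [Matrix.actOn_apply, ← LinearMap.toMatrix'_mulVec d x]
  rfl

theorem Module.Injective.exists_factor {A B J : Type u} [AddCommGroup A] [Module R A]
    [AddCommGroup B] [Module R B] [AddCommGroup J] [Module R J] [Module.Injective R J]
    (g : A →ₗ[R] B) (f : A →ₗ[R] J) (h : LinearMap.ker g ≤ LinearMap.ker f) :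
    ∃ f' : B →ₗ[R] J, f' ∘ₗ g = f := by
  obtain ⟨f', hf'⟩ := Module.Injective.out ((LinearMap.ker g).liftQ g le_rfl)
    (LinearMap.ker_eq_bot.1 (Submodule.ker_liftQ_eq_bot _ _ _ le_rfl)) ((LinearMap.ker g).liftQ f h)
  exact ⟨f', LinearMap.ext fun x => hf' (Submodule.Quotient.mk x)⟩

/-- Under Hom(W, J^k) ≅ Hom(W^k, J), postcomposition with `B` becomes precomposition with its
transpose, and Hom(-, J) is exact. Taking W = R gives exactness of the complex of powers of J, and
taking W injective gives exactness under Hom(W, -). -/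
theorem Matrix.exists_actOn_comp_eq {l k m : ℕ} {A : Matrix (Fin l) (Fin k) R}
    {B : Matrix (Fin k) (Fin m) R} {W J : Type u} [AddCommGroup W] [Module R W] [AddCommGroup J]
    [Module R J] [Module.Injective R J]
    (hex : Function.Exact (A.transpose.actOn W) (B.transpose.actOn W))
    (φ : W →ₗ[R] (Fin k → J)) (hφ : A.actOn J ∘ₗ φ = 0) :
    ∃ ψ : W →ₗ[R] (Fin m → J), B.actOn J ∘ₗ ψ = φ := by
  classical
  let Φ : (Fin k → W) →ₗ[R] J := ∑ a, LinearMap.proj a ∘ₗ φ ∘ₗ LinearMap.proj a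
  have hΦ : ∀ x, Φ x = ∑ a, φ (x a) a := fun x => by simp [Φ, LinearMap.sum_apply]
  have hker : LinearMap.ker (B.transpose.actOn W) ≤ LinearMap.ker Φ := by
    intro x hx
    obtain ⟨y, rfl⟩ := (hex x).1 hx
    rw [LinearMap.mem_ker, hΦ]
    have h0 : ∀ c, ∑ a, A c a • φ (y c) a = 0 := fun c => by
      rw [← Matrix.actOn_apply]
      exact congrFun (LinearMap.congr_fun hφ (y c)) c
    calc ∑ a, φ (A.transpose.actOn W y a) a = ∑ a, ∑ c, A c a • φ (y c) a := by
          refine Finset.sum_congr rfl fun a _ => ?_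
          rw [Matrix.actOn_apply, map_sum, Finset.sum_apply]
          simp
      _ = 0 := by rw [Finset.sum_comm]; simp [h0]
  obtain ⟨Ψ, hΨ⟩ := Module.Injective.exists_factor (B.transpose.actOn W) Φ hker
  refine ⟨LinearMap.pi fun b => Ψ ∘ₗ LinearMap.single R (fun _ => W) b,
    LinearMap.ext fun w => funext fun a => ?_⟩
  have h1 : Φ (Pi.single a w) = φ w a := by
    rw [hΦ, Finset.sum_eq_single a]
    · simp
    · intro b _ hb
      simp [hb]
    · simp
  rw [← h1, ← hΨ, LinearMap.comp_apply, LinearMap.comp_apply, Matrix.actOn_apply]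
  have h2 : B.transpose.actOn W (Pi.single a w) =
      ∑ b, B a b • LinearMap.single R (fun _ => W) b w := by
    refine funext fun b => ?_
    rw [Matrix.actOn_apply, Finset.sum_apply, Finset.sum_eq_single a, Finset.sum_eq_single b]
    · simp
    · intro c _ hc
      simp [hc.symm]
    · simp
    · intro c _ hc
      simp [hc]
    · simp
  rw [h2, map_sum]
  simp

theorem Matrix.actOn_exact {l k m : ℕ} {A : Matrix (Fin l) (Fin k) R}
    {B : Matrix (Fin k) (Fin m) R} {J : Type u} [AddCommGroup J]
    [Module R J] [Module.Injective R J] (hAB : A * B = 0)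
    (hex : Function.Exact (A.transpose.actOn R) (B.transpose.actOn R)) :
    Function.Exact (B.actOn J) (A.actOn J) := by
  intro x
  constructor
  · intro hx
    obtain ⟨ψ, hψ⟩ := Matrix.exists_actOn_comp_eq hex (LinearMap.toSpanSingleton R _ x) (by
      ext
      simp [hx])
    refine ⟨ψ 1, ?_⟩
    have := LinearMap.congr_fun hψ 1
    simpa using this
  · rintro ⟨y, rfl⟩
    refine funext fun a => ?_
    rw [Matrix.actOn_apply]
    simp only [Matrix.actOn_apply, Finset.smul_sum, smul_smul]
    rw [Finset.sum_comm]
    simp only [← Finset.sum_smul, ← Matrix.mul_apply, hAB]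
    simp

theorem Matrix.piScalarRight_lTensor {l k : ℕ} (d : (Fin k → R) →ₗ[R] (Fin l → R)) (J : Type u)
    [AddCommGroup J] [Module R J] (t : J ⊗[R] (Fin k → R)) :
    TensorProduct.piScalarRight R R J (Fin l) (LinearMap.lTensor J d t) =
      (LinearMap.toMatrix' d).actOn J (TensorProduct.piScalarRight R R J (Fin k) t) := by
  induction t using TensorProduct.induction_on with
  | zero => simp
  | add x y hx hy => simp only [map_add, hx, hy]
  | tmul j x =>
    refine funext fun a => ?_
    rw [Matrix.actOn_apply, LinearMap.lTensor_tmul]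
    simp only [TensorProduct.piScalarRight_apply, TensorProduct.piScalarRightHom_tmul, smul_smul]
    rw [← Finset.sum_smul]
    congr 1
    conv_lhs => rw [← LinearMap.toMatrix'_mulVec d x]
    rfl

end MatrixAction

namespace FreeCompleteResolution

open scoped TensorProduct

variable {R : Type u} [CommRing R] (F : FreeCompleteResolution R)

/-- The matrices of the differentials. -/
noncomputable def mat (n : ℤ) : Matrix (Fin (F.k (n + 1))) (Fin (F.k n)) R :=
  LinearMap.toMatrix' (F.d n)

theorem mat_actOn (n : ℤ) : (F.mat n).actOn R = F.d n := Matrix.actOn_toMatrix' _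

theorem mat_mul (n : ℤ) : F.mat (n + 1) * F.mat n = 0 := by
  rw [mat, mat, ← LinearMap.toMatrix'_comp, (F.d_exact n).linearMap_comp_eq_zero, map_zero]

theorem mat_exact (n : ℤ) :
    Function.Exact ((F.mat n).actOn R) ((F.mat (n + 1)).actOn R) := by
  rw [mat_actOn, mat_actOn]
  exact F.d_exact n

/-- The dual complex Hom(F, R) is exact because Ext¹(Z, R) = 0; `key` translates duality into the
adjunction ⟨x, dy⟩ = ⟨dᵗx, y⟩. -/
theorem mat_transpose_exact (n : ℤ) :
    Function.Exact ((F.mat (n + 1)).transpose.actOn R) ((F.mat n).transpose.actOn R) := by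
  have key : ∀ (m : ℤ) (x : Fin (F.k (m + 1)) → R) (y : Fin (F.k m) → R),
      ∑ a, x a * (F.d m y) a = ∑ b, (F.mat m).transpose.actOn R x b * y b := by
    intro m x y
    rw [← mat_actOn]
    simp only [Matrix.actOn_apply, smul_eq_mul, Finset.mul_sum, Finset.sum_mul,
      Matrix.transpose_apply]
    rw [Finset.sum_comm]
    refine Finset.sum_congr rfl fun b _ => Finset.sum_congr rfl fun a _ => ?_
    ring
  have hQ := (F.extAcyclic (n + 1 + 1 + 1)).ext 0
  intro x
  constructor
  · intro hx
    let f : (Fin (F.k (n + 1)) → R) →ₗ[R] R := ∑ a, x a • LinearMap.proj a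
    have hf : ∀ y, f y = ∑ a, x a * y a := fun y => by simp [f, LinearMap.sum_apply]
    obtain ⟨g, hg⟩ := (F.hom_exact n R hQ f).1 (by
      refine LinearMap.ext fun y => ?_
      change f (F.d n y) = 0
      rw [hf, key, hx]
      simp)
    refine ⟨fun c => g (Pi.single c 1), funext fun a => ?_⟩
    have h1 : f (Pi.single a 1) = x a := by simp [hf, Pi.single_apply]
    rw [← h1, ← hg]
    have h2 : ∀ z, g z = ∑ c, g (Pi.single c 1) * z c := by
      intro z
      conv_lhs => rw [pi_eq_sum_univ' z]
      rw [map_sum]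
      refine Finset.sum_congr rfl fun c _ => ?_
      rw [map_smul, smul_eq_mul, mul_comm]
    change _ = g (F.d (n + 1) _)
    rw [h2, key]
    simp [Pi.single_apply]
  · rintro ⟨y, rfl⟩
    refine funext fun a => ?_
    have h1 := key n ((F.mat (n + 1)).transpose.actOn R y) (Pi.single a 1)
    rw [← key, (F.d_exact n).apply_apply_eq_zero] at h1
    simpa [Pi.single_apply] using h1.symm

variable (J : Type u) [AddCommGroup J] [Module R J] [Module.Injective R J]

theorem actOn_exact (n : ℤ) : Function.Exact ((F.mat n).actOn J) ((F.mat (n + 1)).actOn J) :=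
  Matrix.actOn_exact (F.mat_mul n) (F.mat_transpose_exact n)

theorem actOn_transpose_exact (n : ℤ) :
    Function.Exact ((F.mat (n + 1)).transpose.actOn J) ((F.mat n).transpose.actOn J) := by
  refine Matrix.actOn_exact ?_ ?_
  · rw [← Matrix.transpose_mul, mat_mul, Matrix.transpose_zero]
  · rw [Matrix.transpose_transpose, Matrix.transpose_transpose]
    exact F.mat_exact n

/-- The embedding of `J ⊗ Z n` into `J^(k n)`. -/
noncomputable def tensorEmb (n : ℤ) : J ⊗[R] F.Z n →ₗ[R] (Fin (F.k n) → J) :=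
  (TensorProduct.piScalarRight R R J (Fin (F.k n))).toLinearMap ∘ₗ LinearMap.lTensor J (F.i n)

omit [Module.Injective R J] in
theorem tensorEmb_lTensor (n : ℤ) (u : J ⊗[R] (Fin (F.k n) → R)) :
    F.tensorEmb J (n + 1) (LinearMap.lTensor J (F.p n) u) =
      (F.mat n).actOn J (TensorProduct.piScalarRight R R J _ u) := by
  rw [mat, ← Matrix.piScalarRight_lTensor, d, LinearMap.lTensor_comp]
  rfl

/-- Tensoring with J need not preserve the injectivity of `F.i`. A tensor with zero image lifts to a
cycle in a power of J, which is a boundary by `actOn_exact`, and boundaries die in J ⊗ Z. -/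
theorem tensorEmb_injective (n : ℤ) : Function.Injective (F.tensorEmb J n) := by
  obtain ⟨m, rfl⟩ : ∃ m, n = m + 1 + 1 := ⟨n - 2, by ring⟩
  rw [injective_iff_map_eq_zero]
  intro t ht
  obtain ⟨u, rfl⟩ := LinearMap.lTensor_surjective J (F.surjective (m + 1)) t
  rw [tensorEmb_lTensor] at ht
  obtain ⟨v, hv⟩ := (F.actOn_exact J m _).1 ht
  obtain ⟨w, rfl⟩ := (TensorProduct.piScalarRight R R J (Fin (F.k m))).surjective v
  rw [mat, ← Matrix.piScalarRight_lTensor] at hv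
  rw [← (TensorProduct.piScalarRight R R J _).injective hv, ← LinearMap.comp_apply,
    ← LinearMap.lTensor_comp, d, ← LinearMap.comp_assoc, (F.exact (m + 1)).linearMap_comp_eq_zero]
  simp

theorem range_tensorEmb (n : ℤ) :
    LinearMap.range (F.tensorEmb J n) = LinearMap.ker ((F.mat n).actOn J) := by
  obtain ⟨m, rfl⟩ : ∃ m, n = m + 1 := ⟨n - 1, by ring⟩
  rw [(F.actOn_exact J m).linearMap_ker_eq]
  ext x
  constructor
  · rintro ⟨t, rfl⟩
    obtain ⟨u, rfl⟩ := LinearMap.lTensor_surjective J (F.surjective m) t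
    exact ⟨_, (F.tensorEmb_lTensor J m u).symm⟩
  · rintro ⟨v, rfl⟩
    obtain ⟨w, rfl⟩ := (TensorProduct.piScalarRight R R J (Fin (F.k m))).surjective v
    exact ⟨_, F.tensorEmb_lTensor J m w⟩

end FreeCompleteResolution

open scoped TensorProduct in
/-- If `J` is injective and `Ext^j(M, R) = 0` for all `j > 0`, then `J ⊗ M` is Gorenstein
injective. -/
theorem ExtAcyclic.isGorensteinInjective_tensor {R : Type u} [CommRing R] [IsGorensteinLocalRing R]
    {M : Type u} [AddCommGroup M] [Module R M] (hM : ExtAcyclic R M) (J : Type u) [AddCommGroup J]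
    [Module R J] [Module.Injective R J] : IsGorensteinInjective R (J ⊗[R] M) := by
  obtain ⟨F, hF⟩ := hM.exists_freeCompleteResolution
  refine ⟨fun n => ModuleCat.of R (Fin (F.k n) → J), fun n => (F.mat n).actOn J,
    fun n => inferInstanceAs (Module.Injective R (Fin (F.k n) → J)), F.actOn_exact J,
    fun I hI n => ?_, ?_⟩
  · intro φ
    constructor
    · exact Matrix.exists_actOn_comp_eq (F.actOn_transpose_exact I n) φ
    · rintro ⟨ψ, rfl⟩
      refine LinearMap.ext fun x => ?_
      exact (F.actOn_exact J n).apply_apply_eq_zero (ψ x)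
  · have e1 : M ≃ₗ[R] F.Z 0 := (CategoryTheory.eqToIso hF.symm).toLinearEquiv
    exact ⟨(LinearEquiv.lTensor J e1).trans
      ((LinearEquiv.ofInjective _ (F.tensorEmb_injective J 0)).trans
        (LinearEquiv.ofEq _ _ (F.range_tensorEmb J 0)))⟩

theorem extSupport_zero_subset_of_injective {R : Type u} [CommRing R] {A B : Type u}
    [AddCommGroup A] [Module R A] [AddCommGroup B] [Module R B] {f : A →ₗ[R] B}
    (hf : Function.Injective f) (X : Type u) [AddCommGroup X] [Module R X] :
    extSupport R 0 X A ⊆ extSupport R 0 X B := by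
  rw [extSupport_zero, extSupport_zero]
  refine Module.support_subset_of_injective (LinearMap.compRight R f) fun u v huv => ?_
  ext x
  exact hf (LinearMap.congr_fun huv x)

/-! ### Exactness of Cousin complexes in terms of local Ext. -/

namespace SpecFiltration

variable {R : Type u} [CommRing R] (𝓕 : SpecFiltration R)

theorem antitone : Antitone 𝓕.F := antitone_nat_of_succ_le 𝓕.succ_subset

theorem not_le_of_mem_boundary {i : ℕ} {p q : PrimeSpectrum R} (hp : p ∈ 𝓕.boundary i)
    (hq : q ∈ 𝓕.F (i + 1)) : ¬ q ≤ p := fun hqp => by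
  have := le_antisymm hqp ((𝓕.minimal i p hp).2 (𝓕.succ_subset i hq) hqp)
  exact hp.2 (this ▸ hq)

end SpecFiltration

namespace Cousin

variable {R : Type u} [CommRing R] [IsNoetherianRing R] (𝓕 : SpecFiltration R)

section Step

variable {N : Type u} [AddCommGroup N] [Module R N] {i : ℕ}

/-- For p in the boundary some t ∈ q lies outside p. It kills R/q and is invertible on N_p, so every
Ext into that summand vanishes. -/
theorem extSupport_term {q : PrimeSpectrum R} (hq : q ∈ 𝓕.F (i + 1)) (j : ℕ) :
    extSupport R j (R ⧸ q.asIdeal) (Term (𝓕.boundary i) N) = ∅ := by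
  refine extSupport_directSum j _ fun p => ?_
  obtain ⟨t, htq, htp⟩ := SetLike.not_le_iff_exists.1
    (show ¬ q.asIdeal ≤ p.1.asIdeal from 𝓕.not_le_of_mem_boundary p.2 hq)
  exact extSupport_of_bijective (by rwa [Ideal.annihilator_quotient])
    (LocalizedModule.bijective_smul p.1 N htp) j

/-- An associated prime q of the kernel lies in F i, and the hypothesis excludes F (i+1). So q
indexes a summand, and R/q ⊆ N cannot die in N_q. -/
theorem map_injective (hN : Module.support R N ⊆ 𝓕.F i)
    (h : ∀ q ∈ 𝓕.F (i + 1), q ∉ extSupport R 0 (R ⧸ q.asIdeal) N) :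
    Function.Injective (map 𝓕 hN) := by
  rw [← LinearMap.ker_eq_bot]
  by_contra hne
  have : Nontrivial (LinearMap.ker (map 𝓕 hN)) := Submodule.nontrivial_iff_ne_bot.2 hne
  obtain ⟨q', hq'⟩ := associatedPrimes.nonempty R (LinearMap.ker (map 𝓕 hN))
  obtain ⟨hprime, f, hf⟩ := (isAssociatedPrime_iff_exists_injective_linearMap _ _).1 hq'
  let q : PrimeSpectrum R := ⟨q', hprime⟩
  let g : (R ⧸ q.asIdeal) →ₗ[R] N := (LinearMap.ker (map 𝓕 hN)).subtype ∘ₗ f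
  have hg : Function.Injective g := (LinearMap.ker (map 𝓕 hN)).injective_subtype.comp hf
  have hqN : q ∈ 𝓕.F i := hN (Module.support_subset_of_injective g hg
    (mem_support_quotient_prime.2 le_rfl))
  have hqi : q ∈ 𝓕.boundary i := ⟨hqN, fun h' => h q h' (mem_extSupport_zero_of_injective hg)⟩
  have h1 : map 𝓕 hN (g (Submodule.Quotient.mk 1)) = 0 := (f (Submodule.Quotient.mk 1)).2
  have h2 := toTerm_apply (finite_ne_zero 𝓕 hN) (g (Submodule.Quotient.mk 1)) ⟨q, hqi⟩
  change (map 𝓕 hN (g (Submodule.Quotient.mk 1))) ⟨q, hqi⟩ = _ at h2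
  rw [h1] at h2
  obtain ⟨t, ht, htg⟩ := (mkLinearMap_eq_zero_iff q _).1 h2.symm
  rw [← map_smul, ← Submodule.Quotient.mk_smul, smul_eq_mul, mul_one] at htg
  exact ht ((Submodule.Quotient.mk_eq_zero _).1 (hg (htg.trans (map_zero g).symm)))

end Step

variable (M : Type u) [AddCommGroup M] [Module R M] (hM : Module.support R M ⊆ 𝓕.F 0)

theorem π_surjective (i : ℕ) : Function.Surjective (π 𝓕 M hM i) := Submodule.mkQ_surjective _

theorem ι_π_exact (i : ℕ) : Function.Exact (ι 𝓕 M hM i) (π 𝓕 M hM i) :=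
  LinearMap.exact_map_mkQ_range _

/-- `H` says that M has depth at least l at the primes of F l. Each term has no Ext from R/q for q
deeper in the filtration, so passing to the next cokernel costs exactly one degree of depth. -/
theorem notMem_extSupport_stage
    (H : ∀ l j q, q ∈ 𝓕.F l → j < l → q ∉ extSupport R j (R ⧸ q.asIdeal) M) (i : ℕ) :
    ∀ l j q, q ∈ 𝓕.F l → j + i < l →
      q ∉ extSupport R j (R ⧸ q.asIdeal) (stage 𝓕 M hM i).coker := by
  induction i with
  | zero => exact H
  | succ i ih =>
    intro l j q hq hl hqj
    have hinj : Function.Injective (ι 𝓕 M hM i) :=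
      map_injective 𝓕 _ fun q hq => ih (i + 1) 0 q hq (by omega)
    rcases extSupport_cov₃ hinj (ι_π_exact 𝓕 M hM i) (π_surjective 𝓕 M hM i) _ j hqj with h | h
    · have := extSupport_term 𝓕 (N := (stage 𝓕 M hM i).coker)
        (𝓕.antitone (show i + 1 ≤ l by omega) hq) j
      exact Set.notMem_empty q (this ▸ h)
    · exact ih l (j + 1) q hq (by omega) h

theorem ι_injective
    (H : ∀ l j q, q ∈ 𝓕.F l → j < l → q ∉ extSupport R j (R ⧸ q.asIdeal) M) (i : ℕ) :
    Function.Injective (ι 𝓕 M hM i) :=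
  map_injective 𝓕 _ fun q hq => notMem_extSupport_stage 𝓕 M hM H i (i + 1) 0 q hq (by omega)

/-- A converse that recovers depth from exactness: Ext^(j+1) of one stage embeds in Ext^j of the
next, ending with Hom into a term. At stage 0 it bounds the depth of M. -/
theorem extSupport_stage_eq_empty (hinj : ∀ i, Function.Injective (ι 𝓕 M hM i)) (j : ℕ) :
    ∀ i l q, q ∈ 𝓕.F l → j + i < l →
      extSupport R j (R ⧸ q.asIdeal) (stage 𝓕 M hM i).coker = ∅ := by
  have hX : ∀ i l j q, q ∈ 𝓕.F l → i < l → extSupport R j (R ⧸ q.asIdeal) (X 𝓕 M hM i) = ∅ :=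
    fun i l j q hq hl => extSupport_term 𝓕 (𝓕.antitone hl hq) j
  induction j with
  | zero =>
    intro i l q hq hl
    exact Set.subset_eq_empty (extSupport_zero_subset_of_injective (hinj i) _)
      (hX i l 0 q hq (by omega))
  | succ j ih =>
    intro i l q hq hl
    refine Set.subset_eq_empty
      (extSupport_cov₁ (hinj i) (ι_π_exact 𝓕 M hM i) (π_surjective 𝓕 M hM i) _ j) ?_
    rw [ih (i + 1) l q hq (by omega), hX i l (j + 1) q hq (by omega), Set.union_empty]

/-- As d = ι ∘ π and ker π is the image of the previous map, exactness at each spot means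
injectivity of ι on the cokernel there. -/
theorem isGorensteinInjectiveResolution_iff :
    IsGorensteinInjectiveResolution (X 𝓕 M hM) (ε 𝓕 M hM) (d 𝓕 M hM) ↔
      (∀ i, Function.Injective (ι 𝓕 M hM i)) ∧ ∀ i, IsGorensteinInjective R (X 𝓕 M hM i) := by
  constructor
  · rintro ⟨h1, h2, h3, h4⟩
    refine ⟨fun i => ?_, h4⟩
    match i with
    | 0 => exact h1
    | 1 =>
      rw [injective_iff_map_eq_zero]
      intro y hy
      obtain ⟨x, rfl⟩ := π_surjective 𝓕 M hM 0 y
      have h5 := (h2 x).1 hy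
      rw [← LinearMap.mem_ker, ker_π_zero]
      exact h5
    | i + 2 =>
      rw [injective_iff_map_eq_zero]
      intro y hy
      obtain ⟨x, rfl⟩ := π_surjective 𝓕 M hM (i + 1) y
      have h5 := (h3 i x).1 hy
      rw [← LinearMap.mem_ker, ker_π_succ]
      exact h5
  · rintro ⟨h1, h2⟩
    have hd : ∀ i x, d 𝓕 M hM i x = 0 ↔ x ∈ LinearMap.ker (π 𝓕 M hM i) := fun i x =>
      ⟨fun h => h1 (i + 1) (h.trans (map_zero _).symm), fun h => by
        rw [d, LinearMap.comp_apply, LinearMap.mem_ker.1 h, map_zero]⟩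
    refine ⟨h1 0, fun x => ?_, fun i x => ?_, h2⟩
    · rw [hd, ker_π_zero]
      rfl
    · rw [hd, ker_π_succ]
      rfl

end Cousin

/-! ### The Cousin complex of a Gorenstein ring consists of injective modules. -/

section GorensteinCousin

open Cousin

theorem mem_heightFiltration_self {R : Type u} [CommRing R] [IsNoetherianRing R] [Nontrivial R]
    {q : PrimeSpectrum R} {i : ℕ} : q ∈ (heightFiltration R R).F i ↔ i ≤ primeHt q := by
  constructor
  · rintro ⟨h, hi⟩
    rw [moduleHeight_self] at hi
    exact ENat.natCast_le_natCast.1 hi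
  · intro hi
    refine ⟨support_self R ▸ Set.mem_univ q, ?_⟩
    rw [moduleHeight_self]
    exact ENat.natCast_le_natCast.2 hi

theorem mem_boundary_heightFiltration_self {R : Type u} [CommRing R] [IsNoetherianRing R]
    [Nontrivial R] {q : PrimeSpectrum R} {i : ℕ} :
    q ∈ (heightFiltration R R).boundary i ↔ primeHt q = i := by
  rw [SpecFiltration.boundary, Set.mem_sdiff, mem_heightFiltration_self, mem_heightFiltration_self]
  omega

theorem Module.injective_of_extSupport {R : Type u} [CommRing R] {X : Type u} [AddCommGroup X]
    [Module R X] (h : ∀ I : Ideal R, extSupport R 1 (R ⧸ I) X = ∅) : Module.Injective R X := by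
  refine Module.Baer.injective fun I g => ?_
  obtain ⟨ψ, hψ⟩ := exists_extension (f := I.subtype) (g := I.mkQ) I.injective_subtype
    (LinearMap.exact_subtype_mkQ I) (Submodule.mkQ_surjective I) (h I) g
  exact ⟨ψ, fun x hx => LinearMap.congr_fun hψ ⟨x, hx⟩⟩

variable {R : Type u} [CommRing R] [IsGorensteinLocalRing R]

variable (R) in
/-- The modules `coker d^{i-2}` in the Cousin complex of the ring. -/
noncomputable abbrev ringCoker (i : ℕ) : ModuleCat.{u} R :=
  (stage (heightFiltration R R) R (heightFiltration_admits R R) i).coker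

variable (R) in
/-- The terms of the Cousin complex of the ring. -/
noncomputable abbrev ringCousin (i : ℕ) : ModuleCat.{u} R :=
  X (heightFiltration R R) R (heightFiltration_admits R R) i

variable (R) in
theorem ringCousin_ι_injective (i : ℕ) :
    Function.Injective (ι (heightFiltration R R) R (heightFiltration_admits R R) i) := by
  refine ι_injective _ _ _ (fun l j q hq hjl h => ?_) i
  rw [mem_heightFiltration_self] at hq
  rw [mem_extSupport_self_iff] at h
  omega

/-- A summand of the i-th term belongs to a prime p of height exactly i, where the hypothesis kills
Ext¹ into the cokernel and hence into its localization at p. Direct sums and Baer's criterion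
finish. -/
theorem injective_term_of_notMem_extSupport {i : ℕ}
    (h : ∀ (C : Type u) [AddCommGroup C] [Module R C] [Module.Finite R C] (j : ℕ)
      (p : PrimeSpectrum R), primeHt p < j + 1 + i → p ∉ extSupport R (j + 1) C (ringCoker R i)) :
    Module.Injective R (ringCousin R i) := by
  refine Module.injective_of_extSupport fun I => ?_
  change extSupport R 1 (R ⧸ I) (Term _ _) = ∅
  refine extSupport_directSum 1 _ fun p => ?_
  refine extSupport_one_localizedModule (h _ 0 p.1 ?_)
  rw [mem_boundary_heightFiltration_self.1 p.2]
  omega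

/-- The i-th cokernel has injective dimension at most ht p - i at p. The induction also feeds on
itself: the bound at stage i makes the i-th term injective, which shifts Ext into the next cokernel
by one degree. -/
theorem notMem_extSupport_ringCoker (i : ℕ) : ∀ (C : Type u) [AddCommGroup C] [Module R C]
    [Module.Finite R C] (j : ℕ) (p : PrimeSpectrum R), primeHt p < j + 1 + i →
      p ∉ extSupport R (j + 1) C (ringCoker R i) := by
  induction i with
  | zero => exact fun C _ _ _ j p hp => notMem_extSupport_of_primeHt_lt hp
  | succ i ih =>
    intro C _ _ _ j p hp h
    have := injective_term_of_notMem_extSupport ih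
    rcases extSupport_cov₃ (ringCousin_ι_injective R i) (ι_π_exact _ _ _ i)
      (π_surjective _ _ _ i) C (j + 1) h with h | h
    · rw [extSupport_of_injective (N := ringCousin R i)] at h
      exact h
    · exact ih C (j + 1) p (by omega) h

variable (R) in
theorem injective_ringCousin (i : ℕ) : Module.Injective R (ringCousin R i) :=
  injective_term_of_notMem_extSupport (notMem_extSupport_ringCoker i)

theorem primeHt_mono {p q : PrimeSpectrum R} (h : p ≤ q) : primeHt p ≤ primeHt q := by
  rw [← ENat.natCast_le_natCast, coe_primeHt, coe_primeHt]
  exact Order.height_mono h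

theorem le_closedPoint (p : PrimeSpectrum R) : p ≤ IsLocalRing.closedPoint R :=
  IsLocalRing.le_maximalIdeal p.2.ne_top

theorem subsingleton_ringCoker {i : ℕ} (hi : primeHt (IsLocalRing.closedPoint R) < i) :
    Subsingleton (ringCoker R i) := by
  rw [← Module.support_eq_empty_iff (R := R), Set.eq_empty_iff_forall_notMem]
  intro q hq
  have h1 := (stage (heightFiltration R R) R (heightFiltration_admits R R) _).support_subset hq
  rw [mem_heightFiltration_self] at h1
  have := primeHt_mono (le_closedPoint q)
  omega

end GorensteinCousin

/-! ### Base change from the Cousin complex of R to that of M. -/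

section RestrictDirectSum

variable {R : Type u} [CommRing R] {κ : Type u} {S S' : Set κ}

/-- Restriction of a direct sum to a subset of the index set. -/
noncomputable def DirectSum.restrict (h : S ⊆ S') (A : S' → Type u) [∀ p, AddCommGroup (A p)]
    [∀ p, Module R (A p)] : (⨁ p, A p) →ₗ[R] ⨁ p : S, A (Set.inclusion h p) where
  toFun := DFinsupp.comapDomain (Set.inclusion h) (Set.inclusion_injective h)
  map_add' x y := DFinsupp.comapDomain_add _ _ x y
  map_smul' r x := DFinsupp.comapDomain_smul _ _ r x

theorem DirectSum.restrict_apply (h : S ⊆ S') (A : S' → Type u) [∀ p, AddCommGroup (A p)]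
    [∀ p, Module R (A p)] (x : ⨁ p, A p) (p : S) :
    DirectSum.restrict (R := R) h A x p = x (Set.inclusion h p) :=
  DFinsupp.comapDomain_apply _ (Set.inclusion_injective h) x p

theorem DirectSum.bijective_restrict (h : S ⊆ S') (A : S' → Type u) [∀ p, AddCommGroup (A p)]
    [∀ p, Module R (A p)] (hA : ∀ p : S', p.1 ∉ S → Subsingleton (A p)) :
    Function.Bijective (DirectSum.restrict (R := R) h A) := by
  classical
  constructor
  · intro x y hxy
    refine DFinsupp.ext fun p => ?_
    by_cases hp : p.1 ∈ S
    · have := DFunLike.congr_fun hxy ⟨p.1, hp⟩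
      rwa [restrict_apply, restrict_apply] at this
    · have := hA p hp
      exact Subsingleton.elim _ _
  · rw [← LinearMap.range_eq_top, eq_top_iff]
    rintro y -
    induction y using DirectSum.induction_on with
    | zero => exact zero_mem _
    | add y z hy hz => exact add_mem hy hz
    | of p z =>
      refine ⟨DirectSum.of A (Set.inclusion h p) z, ?_⟩
      exact DFinsupp.comapDomain_single _ (Set.inclusion_injective h) p z

end RestrictDirectSum

namespace Cousin

open scoped TensorProduct

variable {R : Type u} [CommRing R]

section

variable {N N' M : Type u} [AddCommGroup N] [Module R N] [AddCommGroup N'] [Module R N']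
  [AddCommGroup M] [Module R M]

theorem exists_localizedModule_tensor_equiv (p : PrimeSpectrum R) (e : (N ⊗[R] M) ≃ₗ[R] N') :
    ∃ φ : (LocalizedModule p.asIdeal.primeCompl N ⊗[R] M) ≃ₗ[R]
        LocalizedModule p.asIdeal.primeCompl N',
      ∀ x m, φ (LocalizedModule.mkLinearMap p.asIdeal.primeCompl N x ⊗ₜ m) =
        LocalizedModule.mkLinearMap p.asIdeal.primeCompl N' (e (x ⊗ₜ m)) := by
  let f := TensorProduct.AlgebraTensorModule.rTensor R M
    (LocalizedModule.mkLinearMap p.asIdeal.primeCompl N)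
  let g := LocalizedModule.mkLinearMap p.asIdeal.primeCompl N' ∘ₗ e.toLinearMap
  have : IsLocalizedModule p.asIdeal.primeCompl g := IsLocalizedModule.of_linearEquiv_right _ _ e
  exact ⟨IsLocalizedModule.linearEquiv p.asIdeal.primeCompl f g, fun x m =>
    IsLocalizedModule.linearEquiv_apply p.asIdeal.primeCompl f g (x ⊗ₜ m)⟩

theorem subsingleton_localizedModule_tensor {p : PrimeSpectrum R}
    (hp : p ∉ Module.support R M) :
    Subsingleton (LocalizedModule p.asIdeal.primeCompl N ⊗[R] M) := by
  refine subsingleton_of_forall_eq 0 fun z => ?_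
  induction z with
  | zero => rfl
  | add y z hy hz => rw [hy, hz, add_zero]
  | tmul x m =>
    obtain ⟨s, hs, hsm⟩ := Module.notMem_support_iff'.1 hp m
    obtain ⟨y, rfl⟩ := (LocalizedModule.bijective_smul p N hs).2 x
    change (s • y) ⊗ₜ m = 0
    rw [TensorProduct.smul_tmul, hsm, TensorProduct.tmul_zero]

/-- N_p ⊗ M is the localization of N ⊗ M at p and vanishes for p outside the support of M, so the
larger index set does no harm. Compatibility with the localization maps is what lets the isomorphism
descend to cokernels. -/
theorem exists_term_tensor_equiv {S S' : Set (PrimeSpectrum R)} (hS : S ⊆ S')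
    (hS' : ∀ p ∈ S', p ∉ S → p ∉ Module.support R M) (e : (N ⊗[R] M) ≃ₗ[R] N')
    (h : ∀ x : N, {p : S' | LocalizedModule.mkLinearMap p.1.asIdeal.primeCompl N x ≠ 0}.Finite)
    (h' : ∀ x : N', {p : S | LocalizedModule.mkLinearMap p.1.asIdeal.primeCompl N' x ≠ 0}.Finite) :
    ∃ Φ : (Term S' N ⊗[R] M) ≃ₗ[R] Term S N',
      Φ.toLinearMap ∘ₗ (toTerm h).rTensor M = toTerm h' ∘ₗ e.toLinearMap := by
  classical
  choose φ hφ using fun p : S => exists_localizedModule_tensor_equiv p.1 e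
  let ρ := LinearEquiv.ofBijective _ (DirectSum.bijective_restrict (R := R) hS
    (fun p : S' => LocalizedModule p.1.asIdeal.primeCompl N ⊗[R] M)
    fun p hp => subsingleton_localizedModule_tensor (hS' p.1 p.2 hp))
  let Φ : (Term S' N ⊗[R] M) ≃ₗ[R] Term S N' :=
    TensorProduct.directSumLeft R R
      (fun p : S' => LocalizedModule p.1.asIdeal.primeCompl N) M ≪≫ₗ ρ ≪≫ₗ
      DFinsupp.mapRange.linearEquiv φ
  refine ⟨Φ, TensorProduct.ext' fun x m => DFinsupp.ext fun p => ?_⟩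
  have h1 : Φ (toTerm h x ⊗ₜ m) p = φ p (ρ (TensorProduct.directSumLeft R R
      (fun p : S' => LocalizedModule p.1.asIdeal.primeCompl N) M (toTerm h x ⊗ₜ m)) p) :=
    DFinsupp.mapRange_apply (fun p => φ p) (fun p => (φ p).map_zero) _ _
  have h2 : ∀ z, ρ z p = z (Set.inclusion hS p) := fun z => DirectSum.restrict_apply hS _ z p
  rw [h2, TensorProduct.directSumLeft_tmul, toTerm_apply] at h1
  change Φ (toTerm h x ⊗ₜ m) p = toTerm h' (e (x ⊗ₜ m)) p
  rw [h1, toTerm_apply]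
  exact hφ p x m

end

section

variable [IsGorensteinLocalRing R] {M : Type u} [AddCommGroup M] [Module R M]

theorem boundary_heightFiltration_subset (hM : ExtAcyclic R M) (i : ℕ) :
    (heightFiltration R M).boundary i ⊆ (heightFiltration R R).boundary i := by
  have := hM.finite
  rintro q ⟨⟨hq, h1⟩, h2⟩
  rw [mem_boundary_heightFiltration_self]
  rw [moduleHeight_eq_primeHt hM.ext, ENat.natCast_le_natCast] at h1
  refine le_antisymm (not_lt.1 fun h3 => h2 ⟨hq, ?_⟩) h1
  rw [moduleHeight_eq_primeHt hM.ext, ENat.natCast_le_natCast]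
  exact h3

theorem notMem_support_of_notMem_boundary (hM : ExtAcyclic R M) {i : ℕ} {q : PrimeSpectrum R}
    (hq : q ∈ (heightFiltration R R).boundary i) (hq' : q ∉ (heightFiltration R M).boundary i) :
    q ∉ Module.support R M := by
  have := hM.finite
  rw [mem_boundary_heightFiltration_self] at hq
  refine fun h => hq' ⟨⟨h, ?_⟩, ?_⟩
  · rw [moduleHeight_eq_primeHt hM.ext, ENat.natCast_le_natCast]
    exact hq.ge
  · rintro ⟨_, h1⟩
    rw [moduleHeight_eq_primeHt hM.ext, ENat.natCast_le_natCast] at h1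
    exact absurd (h1.trans hq.le) (by simp)

theorem exists_map_tensor_equiv (hM : ExtAcyclic R M) {i : ℕ} {N N' : Type u} [AddCommGroup N]
    [Module R N] [AddCommGroup N'] [Module R N']
    (hN : Module.support R N ⊆ (heightFiltration R R).F i)
    (hN' : Module.support R N' ⊆ (heightFiltration R M).F i) (e : (N ⊗[R] M) ≃ₗ[R] N') :
    ∃ Φ : (Term ((heightFiltration R R).boundary i) N ⊗[R] M) ≃ₗ[R]
        Term ((heightFiltration R M).boundary i) N',
      Φ.toLinearMap ∘ₗ (map (heightFiltration R R) hN).rTensor M =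
        map (heightFiltration R M) hN' ∘ₗ e.toLinearMap :=
  exists_term_tensor_equiv (boundary_heightFiltration_subset hM i)
    (fun _ h h' => notMem_support_of_notMem_boundary hM h h') e _ _

/-- Tensoring is right exact, so it commutes with forming each successive cokernel; the induction
starts from R ⊗ M ≅ M. -/
theorem nonempty_coker_tensor_equiv (hM : ExtAcyclic R M) (i : ℕ) :
    Nonempty ((ringCoker R i ⊗[R] M) ≃ₗ[R]
      (stage (heightFiltration R M) M (heightFiltration_admits R M) i).coker) := by
  induction i with
  | zero => exact ⟨TensorProduct.lid R M⟩
  | succ i ih =>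
    obtain ⟨e⟩ := ih
    obtain ⟨Φ, hΦ⟩ := exists_map_tensor_equiv hM
      (stage (heightFiltration R R) R (heightFiltration_admits R R) i).support_subset
      (stage (heightFiltration R M) M (heightFiltration_admits R M) i).support_subset e
    refine ⟨(rTensor.equiv M (LinearMap.exact_map_mkQ_range _)
      (Submodule.mkQ_surjective _)).symm ≪≫ₗ Submodule.Quotient.equiv _ _ Φ ?_⟩
    change Submodule.map Φ.toLinearMap _ = _
    rw [← LinearMap.range_comp]
    erw [hΦ]
    rw [LinearMap.range_comp, LinearEquiv.range, Submodule.map_top]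

/-- The terms of the Cousin complex of `M` are obtained from those of the ring by base change. -/
theorem nonempty_term_tensor_equiv (hM : ExtAcyclic R M) (i : ℕ) :
    Nonempty ((ringCousin R i ⊗[R] M) ≃ₗ[R]
      X (heightFiltration R M) M (heightFiltration_admits R M) i) := by
  obtain ⟨e⟩ := nonempty_coker_tensor_equiv hM i
  obtain ⟨Φ, _⟩ := exists_map_tensor_equiv hM
    (stage (heightFiltration R R) R (heightFiltration_admits R R) i).support_subset
    (stage (heightFiltration R M) M (heightFiltration_admits R M) i).support_subset e
  exact ⟨Φ⟩

end

end Cousin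

theorem IsGorensteinInjective.of_linearEquiv {R : Type u} [CommRing R] {Y Y' : Type u}
    [AddCommGroup Y] [Module R Y] [AddCommGroup Y'] [Module R Y'] (e : Y ≃ₗ[R] Y')
    (hY : IsGorensteinInjective R Y) : IsGorensteinInjective R Y' := by
  obtain ⟨E, d, h1, h2, h3, ⟨f⟩⟩ := hY
  exact ⟨E, d, h1, h2, h3, ⟨e.symm ≪≫ₗ f⟩⟩

/-! ### The two implications through Ext-acyclicity. -/

section Main

open Cousin

variable {R : Type u} [CommRing R] [IsGorensteinLocalRing R]
variable {M : Type u} [AddCommGroup M] [Module R M]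

omit [IsGorensteinLocalRing R] in
theorem IsGorensteinProjective.extAcyclic [IsNoetherianRing R] [Module.Finite R M] (hM : IsGorensteinProjective R M) :
    ExtAcyclic R M :=
  ⟨inferInstance, fun j => hM.extSupport_eq_empty R j⟩

theorem ExtAcyclic.isGGorenstein [Nontrivial M] (hM : ExtAcyclic R M) : IsGGorenstein R M := by
  have := hM.finite
  refine ⟨inferInstance, hM.finite, (isGorensteinInjectiveResolution_iff _ _ _).2
    ⟨ι_injective _ _ _ ?_, fun i => ?_⟩⟩
  · rintro l j q ⟨hq, hl⟩ hjl
    rw [moduleHeight_eq_primeHt hM.ext, ENat.natCast_le_natCast] at hl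
    exact notMem_extSupport_of_lt_primeHt hM.ext (hjl.trans_le hl)
  · obtain ⟨e⟩ := nonempty_term_tensor_equiv hM i
    have := injective_ringCousin R i
    exact (hM.isGorensteinInjective_tensor (ringCousin R i)).of_linearEquiv e

/-- The cokernels of C(R) vanish beyond the dimension of R. Descending from there along the
sequences with injective middle term, each cokernel inherits the vanishing of Ext into Y. -/
theorem IsGorensteinInjective.extSupport_ringCoker_eq_empty {Y : Type u} [AddCommGroup Y]
    [Module R Y] (hY : IsGorensteinInjective R Y) (i j : ℕ) :
    extSupport R (j + 1) (ringCoker R i) Y = ∅ := by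
  have hstep : ∀ i, (∀ j, extSupport R (j + 1) (ringCoker R (i + 1)) Y = ∅) →
      ∀ j, extSupport R (j + 1) (ringCoker R i) Y = ∅ := fun i h j => by
    have := injective_ringCousin R i
    refine Set.subset_eq_empty (extSupport_contra₁ (ringCousin_ι_injective R i)
      (ι_π_exact _ _ _ i) (π_surjective _ _ _ i) Y (j + 1)) ?_
    rw [hY.extSupport_eq_empty (ringCousin R i) j, h (j + 1), Set.union_empty]
  have hdown : ∀ k, (∀ j, extSupport R (j + 1) (ringCoker R (i + k)) Y = ∅) →
      ∀ j, extSupport R (j + 1) (ringCoker R i) Y = ∅ := by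
    intro k
    induction k with
    | zero => exact id
    | succ k ih => exact fun h => ih (hstep _ h)
  refine hdown (primeHt (IsLocalRing.closedPoint R) + 1) (fun j => ?_) j
  have := subsingleton_ringCoker (R := R)
    (show _ < i + (primeHt (IsLocalRing.closedPoint R) + 1) by omega)
  refine Set.subset_eq_empty (extSupport_subset_left (j + 1)) ?_
  exact Module.support_eq_empty

omit [IsGorensteinLocalRing R] in
/-- There are no nonzero maps from `R_q` to `M_p` if some element of `p` is not in `q` and `p` is
minimal in the support of `M`. -/
theorem LocalizedModule.linearMap_eq_zero {N : Type u} [AddCommGroup N]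
    [Module R N] {p : PrimeSpectrum R} [Module.Finite R M]
    (hp : Minimal (· ∈ Module.support R M) p)
    {q : PrimeSpectrum R} (hpq : ¬ p ≤ q)
    (ψ : LocalizedModule q.asIdeal.primeCompl N →ₗ[R] LocalizedModule p.asIdeal.primeCompl M) :
    ψ = 0 := by
  obtain ⟨t, htp, htq⟩ := SetLike.not_le_iff_exists.1
    (show ¬ p.asIdeal ≤ q.asIdeal from hpq)
  -- By minimality p is the only prime inside p containing the annihilator of M, so t ∈ p is
  -- nilpotent modulo that annihilator up to a multiplier s ∉ p. Thus t^k kills M_p while acting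
  -- invertibly on N_q.
  obtain ⟨k, s, hs, hsk⟩ : ∃ (k : ℕ) (s : R), s ∉ p.asIdeal ∧
      s * t ^ k ∈ Module.annihilator R M := by
    let T : Submonoid R := p.asIdeal.primeCompl ⊔ Submonoid.powers t
    by_cases hd : Disjoint ((Module.annihilator R M : Ideal R) : Set R) (T : Set R)
    · obtain ⟨r, hr, hxr, hrT⟩ := Ideal.exists_le_prime_disjoint _ T hd
      have hrp : r ≤ p.asIdeal := by
        intro b hb
        by_contra hbp
        exact Set.disjoint_left.1 hrT hb ((le_sup_left : p.asIdeal.primeCompl ≤ T) hbp)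
      have hr' : (⟨r, hr⟩ : PrimeSpectrum R) ∈ Module.support R M :=
        Module.mem_support_iff_of_finite.2 hxr
      exact absurd ((le_sup_right : Submonoid.powers t ≤ T) (Submonoid.mem_powers t))
        (Set.disjoint_left.1 hrT (hp.2 hr' hrp htp))
    · obtain ⟨b, hbx, hbT⟩ := Set.not_disjoint_iff.1 hd
      obtain ⟨s, hs, _, ⟨k, rfl⟩, rfl⟩ := Submonoid.mem_sup.1 hbT
      exact ⟨k, s, hs, hbx⟩
  refine LinearMap.ext fun x => ?_
  obtain ⟨y, rfl⟩ := (LocalizedModule.bijective_smul q N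
    (fun h => htq (q.2.mem_of_pow_mem k h) : t ^ k ∉ q.asIdeal)).2 x
  refine (LocalizedModule.bijective_smul p M hs).1 ?_
  change s • ψ (t ^ k • y) = s • 0
  rw [map_smul, smul_smul, smul_zero]
  induction ψ y using LocalizedModule.induction_on with
  | h m u =>
    rw [LocalizedModule.smul'_mk, Module.mem_annihilator.1 hsk, LocalizedModule.zero_mk]

/-- Otherwise no minimal prime of the support of M lies below a prime of height zero, and every map
from the zeroth term of C(R) to M^0 is zero. But 1 ↦ ε(m) extends to such a map, since Ext¹ from the
next ring cokernel into M^0 vanishes; this contradicts injectivity of ε. -/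
theorem IsGGorenstein.exists_primeHt_eq_zero (hM : IsGGorenstein R M) :
    ∃ p ∈ Module.support R M, primeHt p = 0 := by
  classical
  obtain ⟨hnt, hfin, hres⟩ := hM
  obtain ⟨hinj, hGI⟩ := (isGorensteinInjectiveResolution_iff _ _ _).1 hres
  by_contra! hne
  have hzero : ∀ ψ : Term ((heightFiltration R R).boundary 0) R →ₗ[R]
      Term ((heightFiltration R M).boundary 0) M, ψ = 0 := by
    intro ψ
    refine DirectSum.linearMap_ext R fun q => LinearMap.ext fun x => DFinsupp.ext fun p => ?_
    have hp := (heightFiltration R M).minimal 0 p.1 p.2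
    have hpS : ∀ r, r ∈ (heightFiltration R M).F 0 ↔ r ∈ Module.support R M := fun r =>
      ⟨fun h => h.1, fun h => heightFiltration_admits R M h⟩
    simp only [hpS] at hp
    have hpq : ¬ p.1 ≤ q.1 := fun h => by
      have h1 := primeHt_mono h
      rw [mem_boundary_heightFiltration_self.1 q.2] at h1
      exact hne p.1 hp.1 (Nat.le_zero.1 h1)
    exact LinearMap.congr_fun (LocalizedModule.linearMap_eq_zero hp hpq
      (DirectSum.component R _ (fun p : (heightFiltration R M).boundary 0 =>
        LocalizedModule p.1.asIdeal.primeCompl M) p ∘ₗ ψ ∘ₗ DirectSum.lof R _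
        (fun q : (heightFiltration R R).boundary 0 =>
          LocalizedModule q.1.asIdeal.primeCompl R) q)) x
  obtain ⟨m, hm⟩ := exists_ne (0 : M)
  let ε₀ : M →ₗ[R] X (heightFiltration R M) M (heightFiltration_admits R M) 0 :=
    ι (heightFiltration R M) M (heightFiltration_admits R M) 0
  obtain ⟨ψ, hψ⟩ := exists_extension (ringCousin_ι_injective R 0) (ι_π_exact _ _ _ 0)
    (π_surjective _ _ _ 0) ((hGI 0).extSupport_ringCoker_eq_empty 1 0)
    (LinearMap.toSpanSingleton R _ (ε₀ m))
  have h0 : ψ = 0 := hzero ψ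
  rw [h0] at hψ
  have h1 : 0 = (1 : R) • ε₀ m := LinearMap.congr_fun hψ (1 : R)
  rw [one_smul] at h1
  exact hm (hinj 0 (h1.symm.trans (map_zero ε₀).symm))

/-- The prime of height zero places 𝔪 at level dim R of the M-height filtration, so exactness of
C(M) gives depth at least dim R at 𝔪. This kills the higher Ext(M, R) at 𝔪, hence everywhere, as
supports are closed under specialization. -/
theorem IsGGorenstein.extAcyclic (hM : IsGGorenstein R M) : ExtAcyclic R M := by
  obtain ⟨p, hp, hp0⟩ := hM.exists_primeHt_eq_zero
  obtain ⟨_, hfin, hres⟩ := hM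
  obtain ⟨hinj, _⟩ := (isGorensteinInjectiveResolution_iff _ _ _).1 hres
  have hm : IsLocalRing.closedPoint R ∈ Module.support R M :=
    Module.mem_support_mono (le_closedPoint p) hp
  have hF : IsLocalRing.closedPoint R ∈
      (heightFiltration R M).F (primeHt (IsLocalRing.closedPoint R)) :=
    ⟨hm, primeHt_le_moduleHeight hp hp0 ⟨_, hm⟩ (le_closedPoint p)⟩
  refine ⟨hfin, fun j => Set.eq_empty_of_forall_notMem fun q hq => ?_⟩
  refine notMem_extSupport_of_depth (m := primeHt (IsLocalRing.closedPoint R))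
    (fun C _ _ _ j hj => notMem_extSupport_of_primeHt_lt hj)
    (primeHt (IsLocalRing.closedPoint R)) M (fun i hi h => ?_) (j + 1) (by omega)
    (Module.mem_support_mono (le_closedPoint q) hq)
  exact Set.notMem_empty _
    ((extSupport_stage_eq_empty _ _ _ hinj i 0 _ _ hF (by omega)).subset h)

end Main

theorem proposition3p9 (R : Type u) [CommRing R] [IsGorensteinLocalRing R]
    (M : Type u) [AddCommGroup M] [Module R M] [Nontrivial M] [Module.Finite R M] :
    IsGGorenstein R M ↔ IsGorensteinProjective R M :=
  ⟨fun h => h.extAcyclic.isGorensteinProjective, fun h => h.extAcyclic.isGGorenstein⟩
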